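/- Let $(W,S)$ be a Coxeter system with $S$ finite, with Coxeter matrix $(m_{st})$, and let $L$ be its nerve: the simplicial complex with vertex set $S$ whose simplices are the nonempty spherical subsets $T\subseteq S$ (those for which the subgroup $W_T=\langle T\rangle$ is finite). The Coxeter diagram of $T\subseteq S$ is the graph on $T$ in which $s,t$ are joined iff $m_{st}>2$ (including $m_{st}=\infty$). Let $S_\oslash$ be the set, ordered by inclusion, of the nonempty spherical subsets whose diagram is connected. A finite subset $\alpha\subseteq S_\oslash$ is nested if $\alpha=\emptyset$, or if $\bigcup_{T\in\alpha}T$ is spherical, the maximal elements $T_1,\dots,T_k$ of $\alpha$ are exactly the vertex sets of the connected components of the diagram of $\bigcup_{T\in\alpha}T$, and (inductively) $\{T\in\alpha : T\subsetneq T_i\}$ is nested for each $i$. Let $L_\oslash$ be the simplicial complex with vertex set $S_\oslash$ whose simplices are the nonempty nested subsets. For a finite simplicial complex $K$ with vertex set $V$, its octahedralization $OK$ is the simplicial complex with vertex set $V\times\{\pm1\}$ in which a set of vertices spans a simplex iff its first coordinates are distinct and span a simplex of $K$. The configuration space $\mathcal C(K)$ is the quotient of the deleted product $\bigcup\{\sigma\times\tau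 : \sigma,\tau \text{ disjoint simplices of } K\}\subseteq K\times K$ by the free involution switching the factors. If $c:\mathcal C(K)\to\mathbb{RP}^\infty$ classifies this double cover and $w$ generates $H^1(\mathbb{RP}^\infty;\mathbb Z/2)$, then $K$ is an $m$-obstructor if the van Kampen obstruction $c^*(w^m)\in H^m(\mathcal C(K);\mathbb Z/2)$ is nonzero. **Theorem 3.3.** If the nerve $L$ of $(W,S)$ has dimension $d\ge 0$, then $OL_\oslash$ is a $2d$-obstructor if and only if $H_d(L;\mathbb Z/2)\neq 0$ (unreduced homology). -/

import Mathlib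

/-! ### Finite abstract simplicial complexes: dimension, mod 2 homology, octahedralization -/

namespace AbstractSimplicialComplex

universe u

variable {V : Type u}

/-- `K` has dimension `d`: it has a `d`-simplex (a face with `d + 1` vertices) and no larger one. -/
def HasDimension (K : AbstractSimplicialComplex V) (d : ℕ) : Prop :=
  (∃ σ ∈ K, σ.card = d + 1) ∧ ∀ σ ∈ K, σ.card ≤ d + 1

/-- The `n`-simplices of `K`. -/
abbrev Simplex (K : AbstractSimplicialComplex V) (n : ℕ) : Type u :=
  {σ : Finset V // σ ∈ K ∧ σ.card = n + 1}

open scoped Classical in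
/-- The codimension-one faces of an `(n + 1)`-simplex. -/
noncomputable def Simplex.facets {K : AbstractSimplicialComplex V} {n : ℕ} (σ : K.Simplex (n + 1)) :
    Finset (K.Simplex n) :=
  (σ.1.image fun x => σ.1.erase x).subtype fun τ => τ ∈ K ∧ τ.card = n + 1

/-- The simplicial boundary `C_{n+1}(K; ℤ/2) → C_n(K; ℤ/2)`. -/
noncomputable def boundary (K : AbstractSimplicialComplex V) (n : ℕ) :
    (K.Simplex (n + 1) →₀ ZMod 2) →ₗ[ZMod 2] (K.Simplex n →₀ ZMod 2) :=
  Finsupp.linearCombination (ZMod 2) fun σ => ∑ τ ∈ σ.facets, Finsupp.single τ 1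

/-- The simplicial cycles `Z_n(K; ℤ/2)`; every `0`-chain is a cycle (homology is not reduced). -/
noncomputable def cycles (K : AbstractSimplicialComplex V) :
    (n : ℕ) → Submodule (ZMod 2) (K.Simplex n →₀ ZMod 2)
  | 0 => ⊤
  | n + 1 => LinearMap.ker (K.boundary n)

/-- The simplicial boundaries, as a submodule of the cycles. -/
noncomputable def boundaries (K : AbstractSimplicialComplex V) (n : ℕ) :
    Submodule (ZMod 2) (K.cycles n) :=
  (LinearMap.range (K.boundary n)).submoduleOf (K.cycles n)

/-- The simplicial homology `H_n(K; ℤ/2)`. -/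
abbrev Homology (K : AbstractSimplicialComplex V) (n : ℕ) : Type u :=
  K.cycles n ⧸ K.boundaries n

open scoped Classical in
/-- The octahedralization `OK`: the vertices are `V × {±1}` (signs are booleans), and a set of
vertices spans a simplex iff its first coordinates are distinct and span a simplex of `K`. -/
def octahedralization (K : AbstractSimplicialComplex V) : AbstractSimplicialComplex (V × Bool) where
  faces := {s | Set.InjOn Prod.fst (s : Set (V × Bool)) ∧ s.image Prod.fst ∈ K}
  isRelLowerSet_faces := by
    rintro s ⟨hs, hK⟩
    have hK' := K.isRelLowerSet_faces hK
    refine ⟨by simpa using hK'.1, fun t hts ht => ⟨hs.mono (by exact_mod_cast hts), ?_⟩⟩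
    exact hK'.2 (Finset.image_subset_image hts) (ht.image _)
  singleton_mem v := by
    refine ⟨by simp, ?_⟩
    rw [Finset.image_singleton]
    exact K.singleton_mem v.1

/-! ### The deleted simplicial product and the configuration space -/

/-- The `n`-cells `σ × τ` of the deleted simplicial product `(K × K) - Δ`: ordered pairs of
disjoint simplices with `dim σ + dim τ = n`. -/
abbrev DelCell (K : AbstractSimplicialComplex V) (n : ℕ) : Type u :=
  {p : Finset V × Finset V // p.1 ∈ K ∧ p.2 ∈ K ∧ Disjoint p.1 p.2 ∧ p.1.card + p.2.card = n + 2}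

/-- The free involution of the deleted product that switches the factors. -/
def DelCell.swap {K : AbstractSimplicialComplex V} {n : ℕ} (p : K.DelCell n) : K.DelCell n :=
  ⟨p.1.swap, p.2.2.1, p.2.1, p.2.2.2.1.symm,
    (add_comm _ _).trans p.2.2.2.2⟩

open scoped Classical in
/-- The codimension-one faces of a cell `σ × τ`: a vertex is removed from `σ` or from `τ`. -/
noncomputable def DelCell.facets {K : AbstractSimplicialComplex V} {n : ℕ} (p : K.DelCell (n + 1)) :
    Finset (K.DelCell n) :=
  ((p.1.1.image fun x => (p.1.1.erase x, p.1.2)) ∪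
    (p.1.2.image fun y => (p.1.1, p.1.2.erase y))).subtype
      fun q => q.1 ∈ K ∧ q.2 ∈ K ∧ Disjoint q.1 q.2 ∧ q.1.card + q.2.card = n + 2

theorem DelCell.mem_facets {K : AbstractSimplicialComplex V} {n : ℕ} {p : K.DelCell (n + 1)}
    {q : K.DelCell n} : q ∈ p.facets ↔ q.1.1 ⊆ p.1.1 ∧ q.1.2 ⊆ p.1.2 := by
  classical
  obtain ⟨⟨σ, τ⟩, h1, h2, h3, h4⟩ := p
  obtain ⟨⟨σ', τ'⟩, h1', h2', h3', h4'⟩ := q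
  simp only [DelCell.facets, Finset.mem_subtype, Finset.mem_union, Finset.mem_image,
    Prod.mk.injEq]
  dsimp only at h4 h4' ⊢
  constructor
  · rintro (⟨x, -, rfl, rfl⟩ | ⟨x, -, rfl, rfl⟩)
    · exact ⟨Finset.erase_subset _ _, subset_rfl⟩
    · exact ⟨subset_rfl, Finset.erase_subset _ _⟩
  · rintro ⟨hs, ht⟩
    have c1 := Finset.card_le_card hs
    have c2 := Finset.card_le_card ht
    by_cases hc : σ'.card = σ.card
    · right
      have e1 := Finset.eq_of_subset_of_card_le hs hc.ge
      have hss : τ' ⊂ τ := Finset.ssubset_iff_subset_ne.2 ⟨ht, by rintro rfl; omega⟩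
      obtain ⟨y, hy, hy'⟩ := Finset.exists_of_ssubset hss
      refine ⟨y, hy, e1.symm, (Finset.eq_of_subset_of_card_le ?_ ?_).symm⟩
      · exact fun z hz => Finset.mem_erase.2 ⟨fun e => hy' (e ▸ hz), ht hz⟩
      · rw [Finset.card_erase_of_mem hy]; omega
    · left
      have hss : σ' ⊂ σ := Finset.ssubset_iff_subset_ne.2 ⟨hs, by rintro rfl; omega⟩
      obtain ⟨y, hy, hy'⟩ := Finset.exists_of_ssubset hss
      have e1 := Finset.eq_of_subset_of_card_le ht (by omega)
      refine ⟨y, hy, (Finset.eq_of_subset_of_card_le ?_ ?_).symm, e1.symm⟩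
      · exact fun z hz => Finset.mem_erase.2 ⟨fun e => hy' (e ▸ hz), hs hz⟩
      · rw [Finset.card_erase_of_mem hy]; omega

@[simp] theorem DelCell.swap_swap {K : AbstractSimplicialComplex V} {n : ℕ} (p : K.DelCell n) :
    p.swap.swap = p := rfl

theorem DelCell.swap_ne {K : AbstractSimplicialComplex V} {n : ℕ} (p : K.DelCell n) :
    p.swap ≠ p := by
  intro h
  have h1 : p.1.2 = p.1.1 := congrArg (fun q : K.DelCell n => q.1.1) h
  have h2 := p.2.2.2.1
  rw [h1, disjoint_self] at h2
  exact (K.isRelLowerSet_faces p.2.1).1.ne_empty h2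

theorem DelCell.swap_mem_facets {K : AbstractSimplicialComplex V} {n : ℕ} {p : K.DelCell (n + 1)}
    {q : K.DelCell n} : q.swap ∈ p.swap.facets ↔ q ∈ p.facets := by
  rw [mem_facets, mem_facets]
  exact and_comm

theorem DelCell.sum_facets_swap {K : AbstractSimplicialComplex V} {n : ℕ} (p : K.DelCell (n + 1))
    {A : Type*} [AddCommMonoid A] (f : K.DelCell n → A) :
    ∑ q ∈ p.swap.facets, f q = ∑ q ∈ p.facets, f q.swap :=
  Finset.sum_nbij' DelCell.swap DelCell.swap (fun q hq => by rwa [← swap_mem_facets, swap_swap])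
    (fun q hq => by rwa [swap_mem_facets]) (fun _ _ => rfl) (fun _ _ => rfl) (fun _ _ => rfl)

/-- The cellular cochains `C^n(𝒞(K); ℤ/2)` of the configuration space `𝒞(K)`, the quotient of the
deleted product by the free involution. The cells of `𝒞(K)` are the orbits `{σ × τ, τ × σ}`, so a
cochain is a function on the cells of the deleted product that is invariant under the
involution. -/
def confCochain (K : AbstractSimplicialComplex V) (n : ℕ) :
    Submodule (ZMod 2) (K.DelCell n → ZMod 2) where
  carrier := {f | ∀ p, f p.swap = f p}
  zero_mem' _ := rfl
  add_mem' hf hg p := by simp [hf p, hg p]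
  smul_mem' c f hf p := by simp [hf p]

/-- The cellular coboundary `C^n(𝒞(K); ℤ/2) → C^{n+1}(𝒞(K); ℤ/2)`. -/
noncomputable def confCoboundary (K : AbstractSimplicialComplex V) (n : ℕ) :
    K.confCochain n →ₗ[ZMod 2] K.confCochain (n + 1) where
  toFun f := ⟨fun p => ∑ q ∈ p.facets, f.1 q, fun p => by
    dsimp only
    rw [DelCell.sum_facets_swap]
    exact Finset.sum_congr rfl fun q _ => f.2 q⟩
  map_add' f g := by ext p; simp [Finset.sum_add_distrib]
  map_smul' c f := by ext p; simp [Finset.mul_sum]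

/-- The cocycles of degree `n` of the configuration space. -/
noncomputable def confCocycles (K : AbstractSimplicialComplex V) (n : ℕ) :
    Submodule (ZMod 2) (K.confCochain n) :=
  LinearMap.ker (K.confCoboundary n)

/-- The coboundaries of degree `n` of the configuration space, as a submodule of the cocycles. -/
noncomputable def confCoboundaries (K : AbstractSimplicialComplex V) :
    (n : ℕ) → Submodule (ZMod 2) (K.confCocycles n)
  | 0 => ⊥
  | n + 1 => (LinearMap.range (K.confCoboundary n)).submoduleOf (K.confCocycles (n + 1))

/-- The cohomology `H^n(𝒞(K); ℤ/2)` of the configuration space. -/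
abbrev ConfCohomology (K : AbstractSimplicialComplex V) (n : ℕ) : Type u :=
  K.confCocycles n ⧸ K.confCoboundaries n

/-! ### The van Kampen obstruction

`ℝP^∞` has the cell structure with one cell in each dimension, and `S^∞` the one that covers it,
with two cells `e^n_+`, `e^n_-` in each dimension, exchanged by the antipodal map, and with
`∂ e^{n+1}_± = e^n_+ + e^n_-` mod 2. The chain group `C_n(S^∞; ℤ/2)` is `Bool → ZMod 2`.
A map `c : 𝒞(K) → ℝP^∞` which classifies the double cover is covered by an equivariant map from the
deleted product to `S^∞`. -/

/-- An equivariant, augmentation preserving cellular chain map `C_*((K × K) - Δ) → C_*(S^∞)`, with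
`ℤ/2` coefficients, given by its values on cells: the chain map of a cellular classifying map `c` of
the double cover of the configuration space (lifted to the covers). As `S^∞` is acyclic and the
involution of the deleted product is free, it is unique up to an equivariant chain homotopy. -/
structure ClassifyingMap (K : AbstractSimplicialComplex V) where
  /-- the image of a cell -/
  map : (n : ℕ) → K.DelCell n → Bool → ZMod 2
  map_swap : ∀ n (p : K.DelCell n) b, map n p.swap b = map n p !b
  boundary_map : ∀ n (p : K.DelCell (n + 1)) b,
    map (n + 1) p true + map (n + 1) p false = ∑ q ∈ p.facets, map n q b
  augmentation : ∀ p : K.DelCell 0, map 0 p true + map 0 p false = 1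

/-- The pull-back `c^*(w^n)` as a cocycle: `w^n ∈ H^n(ℝP^∞; ℤ/2) = ℤ/2` is represented by the
cochain with value `1` on the `n`-cell of `ℝP^∞`, that is, on both `n`-cells of `S^∞`. -/
noncomputable def ClassifyingMap.pullback {K : AbstractSimplicialComplex V} (c : K.ClassifyingMap)
    (n : ℕ) : K.confCocycles n :=
  ⟨⟨fun p => c.map n p true + c.map n p false, fun p => by
      simp [c.map_swap, add_comm]⟩, by
    rw [confCocycles, LinearMap.mem_ker]
    ext p
    change ∑ q ∈ p.facets, (c.map n q true + c.map n q false) = 0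
    rw [Finset.sum_add_distrib, ← c.boundary_map n p true, ← c.boundary_map n p false]
    exact CharTwo.add_self_eq_zero _⟩

section Existence

variable {K : AbstractSimplicialComplex V}

open scoped Classical in
theorem sum_facets {n : ℕ} (p : K.DelCell (n + 1)) (f : K.DelCell n → ZMod 2)
    (F : Finset V × Finset V → ZMod 2) (hF : ∀ q : K.DelCell n, F q.1 = f q)
    (hF' : ∀ q : Finset V × Finset V, q.1 = ∅ ∨ q.2 = ∅ → F q = 0) :
    ∑ q ∈ p.facets, f q =
      ∑ x ∈ p.1.1, F (p.1.1.erase x, p.1.2) + ∑ y ∈ p.1.2, F (p.1.1, p.1.2.erase y) := by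
  obtain ⟨⟨σ, τ⟩, h1, h2, h3, h4⟩ := p
  dsimp only at h1 h2 h3 h4 ⊢
  have hcell : ∀ q ∈ (σ.image fun x => (σ.erase x, τ)) ∪ (τ.image fun y => (σ, τ.erase y)),
      ¬ (q.1 ∈ K ∧ q.2 ∈ K ∧ Disjoint q.1 q.2 ∧ q.1.card + q.2.card = n + 2) → F q = 0 := by
    intro q hq hn
    apply hF'
    by_contra! hne
    apply hn
    simp only [Finset.mem_union, Finset.mem_image] at hq
    rcases hq with ⟨x, hx, rfl⟩ | ⟨x, hx, rfl⟩
    · refine ⟨(K.isRelLowerSet_faces h1).2 (Finset.erase_subset _ _) hne.1,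
        h2, h3.mono_left (Finset.erase_subset _ _), ?_⟩
      have := Finset.card_erase_add_one hx
      dsimp only
      omega
    · refine ⟨h1, (K.isRelLowerSet_faces h2).2 (Finset.erase_subset _ _) hne.2,
        h3.mono_right (Finset.erase_subset _ _), ?_⟩
      have := Finset.card_erase_add_one hx
      dsimp only
      omega
  rw [DelCell.facets, Finset.sum_congr rfl fun q _ => (hF q).symm]
  rw [Finset.sum_subtype_eq_sum_filter, Finset.sum_filter]
  rw [Finset.sum_congr rfl (g := F) fun q hq => by
    split_ifs with h
    · rfl
    · exact (hcell q hq h).symm]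
  rw [Finset.sum_union, Finset.sum_image, Finset.sum_image]
  · intro x hx y hy h
    simp only [Prod.mk.injEq, true_and] at h
    exact (Finset.erase_injOn _) hx hy h
  · intro x hx y hy h
    simp only [Prod.mk.injEq, and_true] at h
    exact (Finset.erase_injOn _) hx hy h
  · rw [Finset.disjoint_left]
    intro q hq hq'
    simp only [Finset.mem_image] at hq hq'
    obtain ⟨x, hx, rfl⟩ := hq
    obtain ⟨y, hy, h⟩ := hq'
    simp only [Prod.mk.injEq] at h
    have := Finset.notMem_erase x σ
    rw [← h.1] at this
    exact this hx

open scoped Classical in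
theorem sum_erase_erase (σ : Finset V) (g : Finset V → ZMod 2) :
    ∑ x ∈ σ, ∑ y ∈ σ.erase x, g ((σ.erase x).erase y) = 0 := by
  rw [Finset.sum_sigma']
  refine Finset.sum_involution (fun a _ => ⟨a.2, a.1⟩) ?_ ?_ ?_ ?_
  · rintro ⟨x, y⟩ -
    dsimp only
    rw [Finset.erase_right_comm]
    exact CharTwo.add_self_eq_zero _
  · rintro ⟨x, y⟩ h - e
    simp only [Finset.mem_sigma, Finset.mem_erase] at h
    simp only [Sigma.mk.injEq] at e
    exact h.2.1 e.1
  · rintro ⟨x, y⟩ h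
    simp only [Finset.mem_sigma, Finset.mem_erase] at h ⊢
    exact ⟨h.2.2, h.2.1.symm, h.1⟩
  · rintro ⟨x, y⟩ -
    rfl

/-- `∂∂ = 0` in the deleted product. -/
theorem DelCell.sum_facets_facets {n : ℕ} (p : K.DelCell (n + 2)) (f : K.DelCell n → ZMod 2) :
    ∑ q ∈ p.facets, ∑ r ∈ q.facets, f r = 0 := by
  classical
  let F : Finset V × Finset V → ZMod 2 := fun q =>
    if h : q.1 ∈ K ∧ q.2 ∈ K ∧ Disjoint q.1 q.2 ∧ q.1.card + q.2.card = n + 2 then f ⟨q, h⟩ else 0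
  have hF : ∀ q : K.DelCell n, F q.1 = f q := fun q => dif_pos q.2
  have hne : ∀ s : Finset V, s ∈ K → s ≠ ∅ := fun s hs => (K.isRelLowerSet_faces hs).1.ne_empty
  have hF' : ∀ q : Finset V × Finset V, q.1 = ∅ ∨ q.2 = ∅ → F q = 0 := fun q hq =>
    dif_neg fun h => hq.elim (hne _ h.1) (hne _ h.2.1)
  let G : Finset V × Finset V → ZMod 2 := fun q =>
    ∑ x ∈ q.1, F (q.1.erase x, q.2) + ∑ y ∈ q.2, F (q.1, q.2.erase y)
  rw [sum_facets p _ G (fun q => (sum_facets q f F hF hF').symm)]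
  · simp only [G, Finset.sum_add_distrib]
    rw [sum_erase_erase p.1.1 fun s => F (s, p.1.2), sum_erase_erase p.1.2 fun s => F (p.1.1, s),
      zero_add, add_zero, Finset.sum_comm]
    exact CharTwo.add_self_eq_zero _
  · rintro ⟨s, t⟩ (h | h)
    · dsimp only at h
      subst h
      simp [G, hF' (∅, _) (Or.inl rfl)]
    · dsimp only at h
      subst h
      simp [G, hF' (_, ∅) (Or.inr rfl)]

/-- A `1`-cell of the deleted product has two end points. -/
theorem DelCell.sum_facets_one (p : K.DelCell 1) : ∑ _q ∈ p.facets, (1 : ZMod 2) = 0 := by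
  classical
  let F : Finset V × Finset V → ZMod 2 := fun q => if q.1 = ∅ ∨ q.2 = ∅ then 0 else 1
  have hne : ∀ s : Finset V, s ∈ K → s ≠ ∅ := fun s hs => (K.isRelLowerSet_faces hs).1.ne_empty
  rw [sum_facets p _ F
    (fun q => if_neg (not_or.2 ⟨hne _ q.2.1, hne _ q.2.2.1⟩)) fun q hq => if_pos hq]
  obtain ⟨⟨σ, τ⟩, h1, h2, h3, h4⟩ := p
  dsimp only at h1 h2 h3 h4 ⊢
  have c1 : 0 < σ.card := Finset.card_pos.2 (K.isRelLowerSet_faces h1).1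
  have c2 : 0 < τ.card := Finset.card_pos.2 (K.isRelLowerSet_faces h2).1
  have key : ∀ s : Finset V, s.card = 1 ∨ s.card = 2 → ∑ x ∈ s,
      (if s.erase x = ∅ then (0 : ZMod 2) else 1) = 0 := by
    rintro s (hs | hs)
    · obtain ⟨a, rfl⟩ := Finset.card_eq_one.1 hs
      simp
    · rw [Finset.sum_congr rfl (g := fun _ => (1 : ZMod 2)) fun x hx => if_neg fun e => by
        have := Finset.card_erase_add_one hx
        rw [e, hs] at this
        simp at this]
      rw [Finset.sum_const, hs]
      rfl
  simp only [F, hne _ h1, hne _ h2, or_false, false_or]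
  rw [key σ (by omega), key τ (by omega), add_zero]

/-- A choice of one cell in each orbit of the involution. -/
def Pos {n : ℕ} (p : K.DelCell n) : Prop := WellOrderingRel p.1.1 p.1.2

theorem pos_swap {n : ℕ} (p : K.DelCell n) : Pos p.swap ↔ ¬ Pos p := by
  constructor
  · exact fun h h' => asymm_of WellOrderingRel h h'
  · intro h
    rcases trichotomous_of WellOrderingRel p.1.1 p.1.2 with h' | h' | h'
    · exact absurd h' h
    · have h2 := p.2.2.2.1
      rw [h', disjoint_self] at h2
      exact absurd h2 (K.isRelLowerSet_faces p.2.2.1).1.ne_empty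
    · exact h'

open scoped Classical in
noncomputable def auxCochain : (n : ℕ) → K.DelCell n → ZMod 2
  | 0, p => if Pos p then 1 else 0
  | n + 1, p => if Pos p then ∑ q ∈ p.facets, auxCochain n q else 0

open scoped Classical in
theorem auxCochain_sum : (n : ℕ) → (p : K.DelCell (n + 1)) →
    ∑ q ∈ p.facets, auxCochain n q.swap = ∑ q ∈ p.facets, auxCochain n q ∧
      auxCochain (n + 1) p + auxCochain (n + 1) p.swap = ∑ q ∈ p.facets, auxCochain n q := by
  have key : ∀ n (p : K.DelCell (n + 1)),
      ∑ q ∈ p.facets, auxCochain n q.swap = ∑ q ∈ p.facets, auxCochain n q →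
      auxCochain (n + 1) p + auxCochain (n + 1) p.swap = ∑ q ∈ p.facets, auxCochain n q := by
    intro n p h
    rw [auxCochain, auxCochain, DelCell.sum_facets_swap, h]
    by_cases hp : Pos p <;> simp [hp, pos_swap]
  intro n
  induction n with
  | zero =>
    intro p
    have h : ∑ q ∈ p.facets, auxCochain 0 q.swap = ∑ q ∈ p.facets, auxCochain 0 q := by
      rw [← CharTwo.add_eq_zero, ← Finset.sum_add_distrib, ← DelCell.sum_facets_one p]
      refine Finset.sum_congr rfl fun q _ => ?_
      rw [auxCochain, auxCochain]
      by_cases hp : Pos q <;> simp [hp, pos_swap]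
    exact ⟨h, key _ p h⟩
  | succ n ih =>
    intro p
    have h : ∑ q ∈ p.facets, auxCochain (n + 1) q.swap = ∑ q ∈ p.facets, auxCochain (n + 1) q := by
      rw [← CharTwo.add_eq_zero, ← Finset.sum_add_distrib,
        ← DelCell.sum_facets_facets p (auxCochain n)]
      refine Finset.sum_congr rfl fun q _ => ?_
      rw [add_comm, (ih q).2]
    exact ⟨h, key _ p h⟩

/-- Classifying maps exist. -/
theorem ClassifyingMap.exists (K : AbstractSimplicialComplex V) : Nonempty K.ClassifyingMap := by
  classical
  refine ⟨⟨fun n p b => auxCochain n (if b then p else p.swap), ?_, ?_, ?_⟩⟩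
  · rintro n p (_ | _) <;> simp
  · rintro n p (_ | _)
    · simpa [(auxCochain_sum n p).1] using (auxCochain_sum n p).2
    · simpa using (auxCochain_sum n p).2
  · intro p
    by_cases hp : Pos p <;> simp [hp, pos_swap, auxCochain]

/-- The class `c^*(w^n)` does not depend on the classifying map. -/
theorem ClassifyingMap.pullback_sub_mem (c c' : K.ClassifyingMap) (n : ℕ) :
    c.pullback n - c'.pullback n ∈ K.confCoboundaries n := by
  classical
  cases n with
  | zero =>
    rw [confCoboundaries, Submodule.mem_bot, sub_eq_zero]
    ext p
    exact (c.augmentation p).trans (c'.augmentation p).symm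
  | succ n =>
    have key : ∀ n, ∃ h : K.DelCell n → ZMod 2, ∀ p : K.DelCell (n + 1),
        (c.map (n + 1) p true + c.map (n + 1) p false) +
          (c'.map (n + 1) p true + c'.map (n + 1) p false) =
        ∑ q ∈ p.facets, (h q + h q.swap) := by
      have step : ∀ n (e : K.DelCell n → ZMod 2),
          (∀ p : K.DelCell (n + 1), ∑ q ∈ p.facets, e q = 0) →
          (∀ p, (c.map n p true + c.map n p false) + (c'.map n p true + c'.map n p false) =
            e p + e p.swap) →
          ∃ h : K.DelCell n → ZMod 2, ∀ p : K.DelCell (n + 1),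
            (c.map (n + 1) p true + c.map (n + 1) p false) +
              (c'.map (n + 1) p true + c'.map (n + 1) p false) =
            ∑ q ∈ p.facets, (h q + h q.swap) := by
        intro n e he heq
        refine ⟨fun p => if Pos p then c.map n p true + c'.map n p true + e p else 0, fun p => ?_⟩
        rw [c.boundary_map n p true, c'.boundary_map n p true, ← Finset.sum_add_distrib]
        refine ((add_zero _).symm.trans (congrArg _ (he p).symm)).trans ?_
        rw [← Finset.sum_add_distrib]
        refine Finset.sum_congr rfl fun q _ => ?_
        by_cases hp : Pos q
        · simp [hp, pos_swap]
        · simp only [hp, pos_swap, c.map_swap, c'.map_swap, if_false, not_false_eq_true, if_true,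
            Bool.not_true, zero_add]
          have := heq q
          generalize c.map n q true = x1 at *
          generalize c.map n q false = x2 at *
          generalize c'.map n q true = x3 at *
          generalize c'.map n q false = x4 at *
          generalize e q = x5 at *
          generalize e q.swap = x6 at *
          revert x1 x2 x3 x4 x5 x6
          decide
      intro n
      induction n with
      | zero =>
        refine step 0 0 (fun p => by simp) fun p => ?_
        rw [c.augmentation, c'.augmentation]
        rfl
      | succ n ih =>
        obtain ⟨h, hh⟩ := ih
        refine step (n + 1) (fun p => ∑ q ∈ p.facets, h q)
          (fun p => DelCell.sum_facets_facets p h) fun p => ?_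
        rw [hh p, DelCell.sum_facets_swap, Finset.sum_add_distrib]
    obtain ⟨h, hh⟩ := key n
    refine ⟨⟨fun q => h q + h q.swap, fun q => add_comm _ _⟩, ?_⟩
    ext p
    change ∑ q ∈ p.facets, (h q + h q.swap) = _
    rw [← hh p, ← CharTwo.sub_eq_add (_ + _)]
    rfl

end Existence

/-- The van Kampen obstruction `vk^m(K) = c^*(w^m) ∈ H^m(𝒞(K); ℤ/2)`, where `c` is a classifying
map of the double cover of the configuration space; the choice of `c` does not matter. -/
noncomputable def vanKampen (K : AbstractSimplicialComplex V) (m : ℕ) : K.ConfCohomology m :=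
  Submodule.Quotient.mk ((ClassifyingMap.exists K).some.pullback m)

theorem vanKampen_eq {K : AbstractSimplicialComplex V} (c : K.ClassifyingMap) (m : ℕ) :
    K.vanKampen m = Submodule.Quotient.mk (c.pullback m) :=
  (Submodule.Quotient.eq _).2 (ClassifyingMap.pullback_sub_mem _ c m)

/-- `K` is an `m`-obstructor if its van Kampen obstruction in degree `m` is not zero. -/
def IsObstructor (K : AbstractSimplicialComplex V) (m : ℕ) : Prop :=
  K.vanKampen m ≠ 0

end AbstractSimplicialComplex

/-! ### The nerve of a Coxeter system and its subdivision `L_⊘` -/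

namespace CoxeterSystem

universe u v

variable {B : Type u} {W : Type v} [Group W] {M : CoxeterMatrix B} (cs : CoxeterSystem M W)

/-- A set `T` of generators is spherical if the special subgroup `W_T` is finite. -/
def IsSpherical (T : Finset B) : Prop :=
  Finite (Subgroup.closure (cs.simple '' (T : Set B)))

theorem IsSpherical.mono {cs : CoxeterSystem M W} {T T' : Finset B} (h : cs.IsSpherical T')
    (hT : T ⊆ T') : cs.IsSpherical T := by
  have : Finite (Subgroup.closure (cs.simple '' (T' : Set B))) := h
  exact Finite.of_injective _ (Subgroup.inclusion_injective
    (Subgroup.closure_mono (Set.image_mono (f := cs.simple) (Finset.coe_subset.2 hT))))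

theorem isSpherical_singleton (s : B) : cs.IsSpherical {s} := by
  unfold IsSpherical
  rw [Finset.coe_singleton, Set.image_singleton, ← Subgroup.zpowers_eq_closure]
  exact (finite_zpowers.2 (isOfFinOrder_iff_pow_eq_one.2 ⟨2, by norm_num, cs.simple_sq s⟩)).to_subtype

/-- The nerve `L` of the Coxeter system: the vertices are the generators, the simplices are the
nonempty spherical sets of generators. -/
def nerve : AbstractSimplicialComplex B where
  faces := {T | T.Nonempty ∧ cs.IsSpherical T}
  isRelLowerSet_faces := fun _ h => ⟨h.1, fun _ ht hne => ⟨hne, h.2.mono ht⟩⟩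
  singleton_mem s := ⟨Finset.singleton_nonempty s, cs.isSpherical_singleton s⟩

/-- The Coxeter diagram (without its labels): `s` and `t` are joined iff `m_{st} > 2`, where
`m_{st} = ∞` is encoded by `M s t = 0`. -/
def diagram (_cs : CoxeterSystem M W) : SimpleGraph B where
  Adj s t := 2 < M s t ∨ M s t = 0
  symm := ⟨fun s t h => by rwa [M.symmetric]⟩
  loopless := ⟨fun s h => by simp at h⟩

/-- The decomposition of `T`: the vertex sets of the connected components of the diagram of `T`. -/
def decomposition (T : Finset B) : Set (Finset B) :=
  {U | ∃ c : (cs.diagram.induce (T : Set B)).ConnectedComponent, (U : Set B) = Subtype.val '' c.supp}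

/-- The set `S_⊘` of irreducible nonempty spherical subsets (`Connected` includes nonempty),
ordered by inclusion. -/
abbrev IrredSpherical : Type u :=
  {T : Finset B // cs.IsSpherical T ∧ (cs.diagram.induce (T : Set B)).Connected}

variable {cs}

open scoped Classical in
/-- The support `sp(α)`: the union of the elements of `α`. -/
noncomputable def support (α : Finset cs.IrredSpherical) : Finset B :=
  α.biUnion Subtype.val

variable (cs)

open scoped Classical in
/-- Nested subsets of `S_⊘`. -/
inductive IsNested : Finset cs.IrredSpherical → Prop
  | empty : IsNested ∅
  | intro (α : Finset cs.IrredSpherical)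
      (spherical : cs.IsSpherical (support α))
      (maximal : Subtype.val '' {T | Maximal (· ∈ α) T} = cs.decomposition (support α))
      (lower : ∀ T, Maximal (· ∈ α) T → IsNested (α.filter (· < T))) : IsNested α

variable {cs}

theorem mem_support {α : Finset cs.IrredSpherical} {s : B} :
    s ∈ support α ↔ ∃ T ∈ α, s ∈ T.1 := by
  simp only [support, Finset.mem_biUnion]

theorem subset_support {α : Finset cs.IrredSpherical} {T : cs.IrredSpherical} (h : T ∈ α) :
    T.1 ⊆ support α := fun _ hs => mem_support.2 ⟨T, h, hs⟩

theorem IsNested.isSpherical {α : Finset cs.IrredSpherical} (h : cs.IsNested α) :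
    cs.IsSpherical (support α) := by
  cases h with
  | empty =>
    have : support (∅ : Finset cs.IrredSpherical) = ∅ := by simp [support]
    unfold IsSpherical
    rw [this, Finset.coe_empty, Set.image_empty, Subgroup.closure_empty]
    infer_instance
  | intro _ h _ _ => exact h

/-- Orthogonality: the diagrams are disjoint and no edge joins them. -/
def Orthogonal (T T' : Finset B) (cs : CoxeterSystem M W) : Prop :=
  ∀ s ∈ T, ∀ t ∈ T', s ≠ t ∧ ¬ cs.diagram.Adj s t

theorem IsNested.pairwise {α : Finset cs.IrredSpherical} (h : cs.IsNested α) :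
    ∀ T ∈ α, ∀ T' ∈ α, T ≤ T' ∨ T' ≤ T ∨ Orthogonal T.1 T'.1 cs := by
  classical
  induction h with
  | empty => simp
  | intro α hs hm _ ih =>
    intro T hT T' hT'
    obtain ⟨U, hTU, hU⟩ := α.exists_le_maximal hT
    obtain ⟨U', hTU', hU'⟩ := α.exists_le_maximal hT'
    by_cases hUU : U = U'
    · subst hUU
      rcases hTU.eq_or_lt with rfl | h1
      · exact Or.inr (Or.inl hTU')
      rcases hTU'.eq_or_lt with rfl | h2
      · exact Or.inl hTU
      have := ih U hU T (by simp [hT, h1]) T' (by simp [hT', h2])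
      exact this
    · right; right
      have m1 : U.1 ∈ cs.decomposition (support α) := hm ▸ ⟨U, hU, rfl⟩
      have m2 : U'.1 ∈ cs.decomposition (support α) := hm ▸ ⟨U', hU', rfl⟩
      obtain ⟨c, hc⟩ := m1
      obtain ⟨c', hc'⟩ := m2
      have hcc : c ≠ c' := by
        rintro rfl
        exact hUU (Subtype.ext (Finset.coe_injective (hc.trans hc'.symm)))
      intro s hs t ht
      have h1 : s ∈ Subtype.val '' c.supp := hc ▸ Finset.mem_coe.2 (hTU hs)
      have h2 : t ∈ Subtype.val '' c'.supp := hc' ▸ Finset.mem_coe.2 (hTU' ht)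
      clear hs ht
      obtain ⟨s, hs, rfl⟩ := h1
      obtain ⟨t, ht, rfl⟩ := h2
      rw [SimpleGraph.ConnectedComponent.mem_supp_iff] at hs ht
      constructor
      · intro e
        exact hcc (by rw [← hs, ← ht, Subtype.ext e])
      · intro hadj
        apply hcc
        rw [← hs, ← ht]
        exact SimpleGraph.ConnectedComponent.connectedComponentMk_eq_of_adj hadj

theorem mem_decomposition {U T : Finset B} (hUT : U ⊆ T)
    (hU : (cs.diagram.induce (U : Set B)).Connected)
    (h : ∀ s ∈ U, ∀ t ∈ T, t ∉ U → ¬ cs.diagram.Adj s t) (v : (T : Set B)) (hv : v.1 ∈ U) :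
    (U : Set B) = Subtype.val ''
      ((cs.diagram.induce (T : Set B)).connectedComponentMk v).supp := by
  ext s
  constructor
  · intro hs
    refine ⟨⟨s, hUT hs⟩, ?_, rfl⟩
    rw [SimpleGraph.ConnectedComponent.mem_supp_iff, SimpleGraph.ConnectedComponent.eq]
    have := hU.preconnected ⟨s, hs⟩ ⟨v.1, hv⟩
    exact this.map (SimpleGraph.induceHomOfLE cs.diagram (Finset.coe_subset.2 hUT)).toHom
  · rintro ⟨t, ht, rfl⟩
    rw [SimpleGraph.ConnectedComponent.mem_supp_iff, SimpleGraph.ConnectedComponent.eq] at ht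
    obtain ⟨w⟩ := ht.symm
    clear ht
    induction w with
    | nil => exact hv
    | @cons a b c hadj w ih =>
      refine ih ?_
      by_contra hb
      exact h _ hv _ b.2 hb hadj

/-- The converse of the pairwise description of nested sets. -/
theorem IsNested.of_pairwise {α : Finset cs.IrredSpherical} (hs : cs.IsSpherical (support α))
    (h : ∀ T ∈ α, ∀ T' ∈ α, T ≤ T' ∨ T' ≤ T ∨ Orthogonal T.1 T'.1 cs) : cs.IsNested α := by
  classical
  induction hn : α.card using Nat.strong_induction_on generalizing α with
  | _ n ih =>
  have hmax : ∀ U, Maximal (· ∈ α) U → ∀ s ∈ U.1, ∀ t ∈ support α, t ∉ U.1 →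
      ¬ cs.diagram.Adj s t := by
    intro U hU s hs t ht htU
    obtain ⟨T, hT, htT⟩ := mem_support.1 ht
    rcases h U hU.1 T hT with h1 | h1 | h1
    · exact absurd (hU.2 hT h1 htT) htU
    · exact absurd (h1 htT) htU
    · exact (h1 s hs t htT).2
  refine .intro α hs ?_ ?_
  · ext U
    constructor
    · rintro ⟨U, hU, rfl⟩
      obtain ⟨⟨v, hv⟩⟩ := U.2.2.nonempty
      exact ⟨_, mem_decomposition (subset_support hU.1) U.2.2 (hmax U hU)
        ⟨v, subset_support hU.1 hv⟩ hv⟩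
    · rintro ⟨c, hc⟩
      obtain ⟨v, rfl⟩ := c.exists_rep
      obtain ⟨T, hT, hvT⟩ := mem_support.1 (Finset.mem_coe.1 v.2)
      obtain ⟨U', hTU, hU'⟩ := α.exists_le_maximal hT
      refine ⟨U', hU', Finset.coe_injective ?_⟩
      rw [hc]
      exact mem_decomposition (subset_support hU'.1) U'.2.2 (hmax U' hU') v (hTU hvT)
  · intro T hT
    refine ih _ ?_ (hs.mono ?_) ?_ rfl
    · rw [← hn]
      refine Finset.card_lt_card (Finset.ssubset_iff_subset_ne.2 ⟨Finset.filter_subset _ _, ?_⟩)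
      intro e
      have := hT.1
      rw [← e] at this
      simp at this
    · exact Finset.biUnion_subset_biUnion_of_subset_left _ (Finset.filter_subset _ _)
    · intro U hU U' hU'
      exact h U (Finset.mem_of_mem_filter _ hU) U' (Finset.mem_of_mem_filter _ hU')

variable (cs)

/-- The subdivision `L_⊘` of the nerve: the vertices are the elements of `S_⊘`, the simplices are
the nonempty nested subsets of `S_⊘`. -/
def subdivision : AbstractSimplicialComplex cs.IrredSpherical where
  faces := {α | α.Nonempty ∧ cs.IsNested α}
  isRelLowerSet_faces := fun α h => ⟨h.1, fun β hβ hne => ⟨hne,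
    .of_pairwise (h.2.isSpherical.mono fun s hs => by
      obtain ⟨T, hT, hsT⟩ := mem_support.1 hs
      exact mem_support.2 ⟨T, hβ hT, hsT⟩)
      fun T hT T' hT' => h.2.pairwise T (hβ hT) T' (hβ hT')⟩⟩
  singleton_mem T := ⟨Finset.singleton_nonempty T, .of_pairwise
    (T.2.1.mono fun s hs => by
      obtain ⟨T', hT, hsT⟩ := mem_support.1 hs
      rwa [Finset.mem_singleton.1 hT] at hsT)
    fun U hU U' hU' => by
      rw [Finset.mem_singleton.1 hU, Finset.mem_singleton.1 hU']
      exact Or.inl le_rfl⟩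

end CoxeterSystem

/-! ### An explicit classifying map from a linear order of the vertices -/

/-! The argument has two halves: a criterion for octahedralizations, and the fact that `L_⊘` is a
flag complex of the same dimension as `L` whose top homology vanishes exactly when that of `L` does.

The van Kampen class is made explicit. After the vertices are ordered linearly, `c^*(w^m)` is
represented by the cochain that is one exactly on the pairs whose vertices alternate between the two
factors (`ClassifyingMap.ofRank`). For `OK` the order places `(v, -1)` immediately before `(v, 1)`.

Let `K` have dimension `d ≥ 1`. If its top homology vanishes, every top cochain of `K` is a
coboundary. For fixed `τ`, whether `σ` alternates with `τ` depends only on the projection of `σ` to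
`K`: disjointness dictates the signs over vertices of `τ`, and the other signs do not influence the
order. So the alternation cochain has a primitive in the variable `σ`, and symmetrizing it kills the
obstruction (`not_isObstructor_octahedralization`).

If `K` is flag and `c` is a nonzero top cycle, fix a simplex `Δ` with `c Δ ≠ 0`. The pairs of
disjoint lifts of simplices in the support of `c`, with positive signs off `Δ` and projections
covering `Δ`, form a `2d`-cycle of the configuration space; flagness is what closes it up
(`sum_isCoveringPair_insert`). The obstruction evaluates to one on it: flipping the sign at a vertex
of `Δ` that is not shared cancels everything except the pairs with both projections equal to `Δ`,
and there alternation forces the negative and the positive lift (`sum_alternating_isCoveringPair`).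

For Coxeter systems, nestedness is a pairwise condition (`isNested_iff`), hence `L_⊘` is flag. A top
cycle of `L` is subdivided by pulling it back along supports. A nested set with `d` elements either
has `d` vertices in its support, where the cycle condition of `L` applies, or `d + 1`, and then it
has exactly two completions. Conversely, a top cycle of `L_⊘` is pushed forward along the simplicial
map sending `T` to its least vertex, for an order of the generators adapted to one simplex `α` of
the cycle; no other simplex of the cycle has the same image as `α`. In dimension zero both sides of
the equivalence always hold. -/

namespace AbstractSimplicialComplex

section Alternating

variable {V : Type*} [DecidableEq V]

/-- For an element `u` of the disjoint union `σ ∪ τ`, ordered by `r`, the parity of the position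
of `u`, plus one if `u ∈ τ`. -/
def positionColor (r : V → ℕ) (σ τ : Finset V) (u : V) : ZMod 2 :=
  ((σ ∪ τ).filter fun v => r v < r u).card + if u ∈ τ then 1 else 0

/-- The indicator of the pairs `(σ, τ)` whose elements alternate with respect to `r`, the least
one being in `σ`. -/
def alternating (r : V → ℕ) (σ τ : Finset V) : ZMod 2 :=
  ∏ u ∈ σ ∪ τ, (positionColor r σ τ u + 1)

/-- Exchanging the two sets adds one to every color, which undoes the `+ 1` in each factor modulo 2.
-/
theorem alternating_swap (r : V → ℕ) {σ τ : Finset V} (h : Disjoint σ τ) :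
    alternating r τ σ = ∏ u ∈ σ ∪ τ, positionColor r σ τ u := by
  unfold alternating
  rw [Finset.union_comm]
  refine Finset.prod_congr rfl fun u hu => ?_
  unfold positionColor
  rw [Finset.union_comm, add_assoc]
  congr 1
  rcases Finset.mem_union.1 hu with hu | hu
  · rw [if_pos hu, if_neg (Finset.disjoint_left.1 h hu)]
    rfl
  · rw [if_pos hu, if_neg (Finset.disjoint_right.1 h hu)]
    rfl

/-- Removing `x` lowers the position of every later vertex by one, so that modulo 2 its factor
`color + 1` turns into `color`; the earlier factors are unchanged. -/
theorem alternating_of_union_eq_erase {r : V → ℕ} (hr : Function.Injective r) {σ τ σ' τ' : Finset V}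
    {x : V} (hx : x ∈ σ ∪ τ) (hU : σ' ∪ τ' = (σ ∪ τ).erase x)
    (hτ : ∀ u, u ≠ x → (u ∈ τ' ↔ u ∈ τ)) :
    alternating r σ' τ' =
      (∏ u ∈ (σ ∪ τ).filter fun u => r u < r x, (positionColor r σ τ u + 1)) *
        ∏ u ∈ (σ ∪ τ).filter fun u => r x < r u, positionColor r σ τ u := by
  have hsplit : σ' ∪ τ' = ((σ ∪ τ).filter fun u => r u < r x) ∪
      ((σ ∪ τ).filter fun u => r x < r u) := by
    rw [hU, ← Finset.filter_or]
    ext u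
    simp only [Finset.mem_erase, Finset.mem_filter]
    rw [← lt_or_lt_iff_ne.trans hr.ne_iff]
    exact and_comm
  unfold alternating
  rw [hsplit, Finset.prod_union]
  · congr 1
    · refine Finset.prod_congr rfl fun u hu => ?_
      have hux := (Finset.mem_filter.1 hu).2
      unfold positionColor
      rw [hU, Finset.filter_erase, Finset.erase_eq_of_notMem]
      · simp only [hτ u (fun e => by simp [e] at hux)]
      · simp [hux.le]
    · refine Finset.prod_congr rfl fun u hu => ?_
      have hux := (Finset.mem_filter.1 hu).2
      unfold positionColor
      have hmem : x ∈ (σ ∪ τ).filter fun v => r v < r u := by simp [hux, Finset.mem_union.1 hx]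
      rw [hU, Finset.filter_erase, ← Finset.card_erase_add_one hmem]
      simp only [hτ u (fun e => by simp [e] at hux), Nat.cast_add, Nat.cast_one]
      ring
  · rw [Finset.disjoint_filter]
    exact fun u _ h1 h2 => lt_asymm h1 h2

/-- The ordered expansion of `∏ (color + 1)` has the leading term `∏ color`, which is the
alternation of the swapped pair, and one term for each vertex, which is the alternation after
deleting that vertex. This is the chain map identity, except that faces with an empty factor are
still included. -/
theorem sum_alternating_erase {r : V → ℕ} (hr : Function.Injective r) {σ τ : Finset V}
    (h : Disjoint σ τ) :
    ∑ x ∈ σ, alternating r (σ.erase x) τ + ∑ y ∈ τ, alternating r σ (τ.erase y) =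
      alternating r σ τ + alternating r τ σ := by
  have key := by
    letI : LinearOrder V := LinearOrder.lift' r hr
    exact Finset.prod_add_ordered (σ ∪ τ) (positionColor r σ τ) fun _ => 1
  rw [alternating_swap r h, alternating, key, add_comm (Finset.prod _ _), add_assoc,
    CharTwo.add_self_eq_zero, add_zero, Finset.sum_union h]
  congr 1
  · refine Finset.sum_congr rfl fun x hx => ?_
    rw [one_mul]
    refine alternating_of_union_eq_erase hr (Finset.mem_union_left _ hx) ?_ fun _ _ => Iff.rfl
    rw [Finset.erase_union_distrib, Finset.erase_eq_of_notMem (Finset.disjoint_left.1 h hx)]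
  · refine Finset.sum_congr rfl fun x hx => ?_
    rw [one_mul]
    refine alternating_of_union_eq_erase hr (Finset.mem_union_right _ hx) ?_ fun u hu => by simp [hu]
    rw [Finset.erase_union_distrib, Finset.erase_eq_of_notMem (Finset.disjoint_right.1 h hx)]

/-- The least vertex lies on the wrong side. With the next lemma, this disposes of the faces that
are not cells of the deleted product. -/
theorem alternating_empty_left (r : V → ℕ) {τ : Finset V} (h : τ.Nonempty) :
    alternating r ∅ τ = 0 := by
  obtain ⟨u, hu, hmin⟩ := τ.exists_min_image r h
  refine Finset.prod_eq_zero (i := u) (by simpa using hu) ?_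
  have : (∅ ∪ τ).filter (fun v => r v < r u) = ∅ := by
    rw [Finset.filter_eq_empty_iff]
    intro v hv
    exact not_lt.2 (hmin v (by simpa using hv))
  rw [positionColor, this, if_pos hu, Finset.card_empty]
  decide

/-- The second least vertex `w` would have to be on the other side. A singleton has no such vertex
and does alternate with the empty set; this exception produces the augmentation. -/
theorem alternating_empty_right {r : V → ℕ} (hr : Function.Injective r) {σ : Finset V}
    (h : 1 < σ.card) : alternating r σ ∅ = 0 := by
  obtain ⟨u, hu, hmin⟩ := σ.exists_min_image r (Finset.card_pos.1 (by omega))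
  obtain ⟨w, hw, hmin'⟩ := (σ.erase u).exists_min_image r (Finset.card_pos.1 (by
    rw [Finset.card_erase_of_mem hu]; omega))
  have hw' := Finset.mem_erase.1 hw
  refine Finset.prod_eq_zero (i := w) (by simpa using hw'.2) ?_
  have : (σ ∪ ∅).filter (fun v => r v < r w) = {u} := by
    ext v
    simp only [Finset.union_empty, Finset.mem_filter, Finset.mem_singleton]
    constructor
    · rintro ⟨hv, hlt⟩
      by_contra hne
      exact absurd (hmin' v (Finset.mem_erase.2 ⟨hne, hv⟩)) (not_le.2 hlt)
    · rintro rfl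
      exact ⟨hu, lt_of_le_of_ne (hmin w hw'.2) fun e => hw'.1 (hr e).symm⟩
  rw [positionColor, this]
  simp
  decide

/-- An order preserving change of vertices does not affect alternation. -/
theorem alternating_image {r : V → ℕ} {σ τ : Finset V} {θ : V → V}
    (hθ : Set.InjOn θ (σ ∪ τ : Finset V))
    (hr : ∀ u ∈ σ ∪ τ, ∀ v ∈ σ ∪ τ, (r (θ u) < r (θ v) ↔ r u < r v)) :
    alternating r (σ.image θ) (τ.image θ) = alternating r σ τ := by
  unfold alternating
  rw [← Finset.image_union, Finset.prod_image hθ]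
  refine Finset.prod_congr rfl fun u hu => ?_
  unfold positionColor
  rw [← Finset.image_union, Finset.filter_image, Finset.card_image_of_injOn]
  · have h1 : (σ ∪ τ).filter (fun v => r (θ v) < r (θ u)) = (σ ∪ τ).filter fun v => r v < r u :=
      Finset.filter_congr fun v hv => hr v hv u hu
    have h2 : θ u ∈ τ.image θ ↔ u ∈ τ := by
      refine ⟨fun h => ?_, Finset.mem_image_of_mem θ⟩
      obtain ⟨v, hv, e⟩ := Finset.mem_image.1 h
      rwa [← hθ (Finset.mem_coe.2 (Finset.mem_union_right _ hv)) (Finset.mem_coe.2 hu) e]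
    rw [h1]
    simp only [h2]
  · exact hθ.mono (Finset.coe_subset.2 (Finset.filter_subset _ _))

end Alternating

variable {V : Type*} {K : AbstractSimplicialComplex V}

theorem nonempty_of_mem {σ : Finset V} (h : σ ∈ K) : σ.Nonempty :=
  (K.isRelLowerSet_faces h).1

theorem mem_of_subset {σ τ : Finset V} (h : τ ∈ K) (hs : σ ⊆ τ) (hne : σ.Nonempty) : σ ∈ K :=
  (K.isRelLowerSet_faces h).2 hs hne

theorem DelCell.sum_facets_eq [DecidableEq V] {n : ℕ} (p : K.DelCell (n + 1))
    (f : K.DelCell n → ZMod 2) (F : Finset V × Finset V → ZMod 2)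
    (hF : ∀ q : K.DelCell n, F q.1 = f q)
    (hF' : ∀ q : Finset V × Finset V, q.1 = ∅ ∨ q.2 = ∅ → F q = 0) :
    ∑ q ∈ p.facets, f q =
      ∑ x ∈ p.1.1, F (p.1.1.erase x, p.1.2) + ∑ y ∈ p.1.2, F (p.1.1, p.1.2.erase y) := by
  convert sum_facets p f F hF hF'

/-- The classifying map given by an injective ranking of the vertices: it maps `σ × τ` to the cell
`e_+` or `e_-` if the vertices of `σ` and `τ` alternate, starting in `σ` or in `τ` respectively. -/
noncomputable def ClassifyingMap.ofRank [DecidableEq V] (K : AbstractSimplicialComplex V)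
    {r : V → ℕ} (hr : Function.Injective r) : K.ClassifyingMap where
  map _ p b := if b then alternating r p.1.1 p.1.2 else alternating r p.1.2 p.1.1
  map_swap n p b := by cases b <;> rfl
  boundary_map n p b := by
    have key : ∀ p : K.DelCell (n + 1), alternating r p.1.1 p.1.2 + alternating r p.1.2 p.1.1 =
        ∑ q ∈ p.facets, alternating r q.1.1 q.1.2 := by
      intro p
      rw [p.sum_facets_eq _
        (fun q => if q.1 = ∅ ∨ q.2 = ∅ then 0 else alternating r q.1 q.2) ?_ ?_]
      · rw [← sum_alternating_erase hr p.2.2.2.1]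
        have hc := p.2.2.2.2
        have h1 := nonempty_of_mem p.2.1
        have h2 := nonempty_of_mem p.2.2.1
        congr 1
        · refine Finset.sum_congr rfl fun x hx => ?_
          have := Finset.card_erase_add_one hx
          by_cases h : p.1.1.erase x = ∅
          · simp [h, alternating_empty_left r h2]
          · simp [h, h2.ne_empty]
        · refine Finset.sum_congr rfl fun x hx => ?_
          have := Finset.card_erase_add_one hx
          by_cases h : p.1.2.erase x = ∅
          · rw [h] at this ⊢
            simp only [or_true, if_true]
            -- An `(n + 1)`-cell has `n + 3` vertices in all, so when the second factor is a point
            -- the first has `n + 2 > 1`.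
            refine alternating_empty_right hr ?_
            simp at this
            omega
          · simp [h, h1.ne_empty]
      · intro q
        exact if_neg (not_or.2 ⟨(nonempty_of_mem q.2.1).ne_empty, (nonempty_of_mem q.2.2.1).ne_empty⟩)
      · intro q hq
        exact if_pos hq
    cases b
    · have := key p.swap
      rw [DelCell.sum_facets_swap] at this
      rw [add_comm] at this
      exact this
    · exact key p
  augmentation p := by
    obtain ⟨⟨σ, τ⟩, h1, h2, h3, h4⟩ := p
    have c1 : 0 < σ.card := Finset.card_pos.2 (nonempty_of_mem h1)
    have c2 : 0 < τ.card := Finset.card_pos.2 (nonempty_of_mem h2)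
    dsimp only at h3 h4
    obtain ⟨a, rfl⟩ := Finset.card_eq_one.1 (show σ.card = 1 by omega)
    obtain ⟨b, rfl⟩ := Finset.card_eq_one.1 (show τ.card = 1 by omega)
    simp only [Bool.false_eq_true, if_true, if_false]
    -- Of the two degenerate faces of a pair of points, `(∅, {b})` contributes zero and `({a}, ∅)`
    -- contributes one.
    rw [← sum_alternating_erase hr h3]
    have e1 : alternating r {a} ∅ = 1 := by
      simp [alternating, positionColor, Finset.filter_singleton]
    simp [alternating_empty_left, e1]

/-- `K` is not an `(n + 1)`-obstructor iff the alternation cochain is a coboundary. -/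
theorem not_isObstructor_succ_iff [DecidableEq V] {r : V → ℕ} (hr : Function.Injective r) {n : ℕ} :
    ¬ K.IsObstructor (n + 1) ↔ ∃ h : Finset V × Finset V → ZMod 2, (∀ q, h q.swap = h q) ∧
      (∀ q : Finset V × Finset V, q.1 = ∅ ∨ q.2 = ∅ → h q = 0) ∧
      ∀ p : K.DelCell (n + 1), alternating r p.1.1 p.1.2 + alternating r p.1.2 p.1.1 =
        ∑ x ∈ p.1.1, h (p.1.1.erase x, p.1.2) + ∑ y ∈ p.1.2, h (p.1.1, p.1.2.erase y) := by
  classical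
  rw [IsObstructor, not_not, vanKampen_eq (ClassifyingMap.ofRank K hr), Submodule.Quotient.mk_eq_zero]
  constructor
  · rintro ⟨h, hh⟩
    let H : Finset V × Finset V → ZMod 2 := fun q =>
      if hq : q.1 ∈ K ∧ q.2 ∈ K ∧ Disjoint q.1 q.2 ∧ q.1.card + q.2.card = n + 2 then h.1 ⟨q, hq⟩
      else 0
    have hH' : ∀ q : Finset V × Finset V, q.1 = ∅ ∨ q.2 = ∅ → H q = 0 := fun q hq =>
      dif_neg fun h => hq.elim (nonempty_of_mem h.1).ne_empty (nonempty_of_mem h.2.1).ne_empty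
    refine ⟨H, ?_, hH', ?_⟩
    · intro q
      by_cases hq : q.1 ∈ K ∧ q.2 ∈ K ∧ Disjoint q.1 q.2 ∧ q.1.card + q.2.card = n + 2
      · have hq' : q.2 ∈ K ∧ q.1 ∈ K ∧ Disjoint q.2 q.1 ∧ q.2.card + q.1.card = n + 2 :=
          ⟨hq.2.1, hq.1, hq.2.2.1.symm, by omega⟩
        have e : H q = h.1 ⟨q, hq⟩ := dif_pos hq
        exact (dif_pos hq').trans ((h.2 ⟨q, hq⟩).trans e.symm)
      · have hq' : ¬ (q.2 ∈ K ∧ q.1 ∈ K ∧ Disjoint q.2 q.1 ∧ q.2.card + q.1.card = n + 2) :=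
          fun hq' => hq ⟨hq'.2.1, hq'.1, hq'.2.2.1.symm, by omega⟩
        have e : H q = 0 := dif_neg hq
        exact (dif_neg hq').trans e.symm
    · intro p
      rw [← p.sum_facets_eq h.1 H (fun q => dif_pos q.2) hH']
      have := congrArg (fun f : K.confCochain (n + 1) => f.1 p) hh
      exact this.symm
  · rintro ⟨h, h1, h2, h3⟩
    refine ⟨⟨fun q => h q.1, fun q => h1 q.1⟩, ?_⟩
    ext p
    exact (p.sum_facets_eq _ h (fun _ => rfl) h2).trans (h3 p).symm

/-- There are no nonzero coboundaries in degree zero, and by the augmentation condition `w^0` takes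
the value one on every cell. -/
theorem isObstructor_zero (h : Nonempty (K.DelCell 0)) : K.IsObstructor 0 := by
  obtain ⟨p⟩ := h
  obtain ⟨c⟩ := ClassifyingMap.exists K
  rw [IsObstructor, vanKampen_eq c, Ne, Submodule.Quotient.mk_eq_zero]
  intro h0
  have h0 : c.pullback 0 = 0 := h0
  have h1 : (c.pullback 0).1.1 p = 0 := by rw [h0]; rfl
  exact one_ne_zero ((c.augmentation p).symm.trans h1)

end AbstractSimplicialComplex

/-! ### Homology in the top dimension -/

namespace AbstractSimplicialComplex

variable {V : Type*} {K : AbstractSimplicialComplex V}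

theorem Simplex.mem_facets {n : ℕ} {σ : K.Simplex (n + 1)} {τ : K.Simplex n} :
    τ ∈ σ.facets ↔ τ.1 ⊆ σ.1 := by
  classical
  obtain ⟨σ, h1, h2⟩ := σ
  obtain ⟨τ, h3, h4⟩ := τ
  simp only [Simplex.facets, Finset.mem_subtype, Finset.mem_image]
  constructor
  · rintro ⟨x, -, rfl⟩
    exact Finset.erase_subset _ _
  · intro h
    obtain ⟨x, hx, hx'⟩ := Finset.exists_of_ssubset
      (Finset.ssubset_iff_subset_ne.2 ⟨h, fun e => by rw [e] at h4; omega⟩)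
    refine ⟨x, hx, (Finset.eq_of_subset_of_card_le ?_ ?_).symm⟩
    · exact fun z hz => Finset.mem_erase.2 ⟨fun e => hx' (e ▸ hz), h hz⟩
    · rw [Finset.card_erase_of_mem hx]
      omega

theorem sum_compl_insert [Fintype V] [DecidableEq V] (c : Finset V → ZMod 2) (τ : Finset V) :
    ∑ y ∈ τᶜ, c (insert y τ) =
      ∑ s ∈ Finset.univ.filter fun s : Finset V => τ ⊆ s ∧ s.card = τ.card + 1, c s := by
  refine Finset.sum_nbij (fun y => insert y τ) ?_ ?_ ?_ fun _ _ => rfl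
  · intro y hy
    simp [Finset.card_insert_of_notMem (Finset.mem_compl.1 hy)]
  · intro y hy z hz e
    have : y ∈ insert z τ := by
      rw [← show insert y τ = insert z τ from e]
      exact Finset.mem_insert_self _ _
    exact (Finset.mem_insert.1 this).resolve_right (by simpa using hy)
  · intro s hs
    simp only [Finset.coe_filter, Finset.mem_univ, true_and, Set.mem_ofPred_eq] at hs
    obtain ⟨x, hx, hx'⟩ := Finset.exists_of_ssubset
      (Finset.ssubset_iff_subset_ne.2 ⟨hs.1, fun e => by rw [e] at hs; omega⟩)
    refine ⟨x, by simpa using hx', Finset.eq_of_subset_of_card_le ?_ ?_⟩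
    · exact Finset.insert_subset hx hs.1
    · rw [Finset.card_insert_of_notMem hx', hs.2]

/-- A `d`-cycle mod 2, as a function on all sets of vertices that vanishes off the
`d`-simplices. -/
structure IsSimplicialCycle [Fintype V] [DecidableEq V] (K : AbstractSimplicialComplex V) (d : ℕ)
    (c : Finset V → ZMod 2) : Prop where
  mem_of_ne_zero : ∀ σ, c σ ≠ 0 → σ ∈ K ∧ σ.card = d + 1
  sum_insert : ∀ ρ, ∑ y ∈ ρᶜ, c (insert y ρ) = 0

theorem boundary_apply [Fintype V] [DecidableEq V] {n : ℕ} {c : Finset V → ZMod 2}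
    (hc : ∀ σ, c σ ≠ 0 → σ ∈ K ∧ σ.card = n + 2)
    (f : K.Simplex (n + 1) →₀ ZMod 2) (hf : ∀ σ, f σ = c σ.1) (τ : K.Simplex n) :
    K.boundary n f τ = ∑ y ∈ τ.1ᶜ, c (insert y τ.1) := by
  classical
  have h1 : K.boundary n f τ = ∑ σ : K.Simplex (n + 1), if τ.1 ⊆ σ.1 then c σ.1 else 0 := by
    rw [boundary, Finsupp.linearCombination_apply, Finsupp.sum_fintype _ _ (by simp),
      Finsupp.finsetSum_apply]
    refine Finset.sum_congr rfl fun σ _ => ?_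
    rw [Finsupp.smul_apply, Finsupp.finsetSum_apply, hf, smul_eq_mul]
    simp only [Finsupp.single_apply]
    rw [Finset.sum_ite_eq' σ.facets τ fun _ => (1 : ZMod 2)]
    simp [Simplex.mem_facets]
  rw [h1, sum_compl_insert]
  refine Finset.sum_bij_ne_zero (fun σ _ _ => σ.1) ?_ ?_ ?_ ?_
  · intro σ _ h
    have := (ite_ne_right_iff.1 h).1
    simp [this, σ.2.2, τ.2.2]
  · intro σ _ _ σ' _ _ e
    exact Subtype.ext e
  · intro s hs h
    simp only [Finset.mem_filter, Finset.mem_univ, true_and] at hs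
    exact ⟨⟨s, hc s h⟩, Finset.mem_univ _, by simpa [hs.1] using h, rfl⟩
  · intro σ _ h
    rw [if_pos (ite_ne_right_iff.1 h).1]

/-- Without `(d + 1)`-simplices there is nothing to divide out. -/
theorem nontrivial_homology_iff_cycles {d : ℕ} (hK : K.HasDimension d) :
    Nontrivial (K.Homology d) ↔ K.cycles d ≠ ⊥ := by
  have : IsEmpty (K.Simplex (d + 1)) := ⟨fun σ => by
    have := hK.2 σ.1 σ.2.1
    have := σ.2.2
    omega⟩
  rw [Submodule.Quotient.nontrivial_iff, boundaries, Ne, Submodule.submoduleOf_eq_top,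
    LinearMap.range_eq_bot.2 (Subsingleton.elim (K.boundary d) 0), le_bot_iff]

theorem nontrivial_homology_zero (hK : K.HasDimension 0) : Nontrivial (K.Homology 0) := by
  rw [nontrivial_homology_iff_cycles hK]
  obtain ⟨σ, h1, h2⟩ := hK.1
  intro h
  have : Finsupp.single (⟨σ, h1, h2⟩ : K.Simplex 0) (1 : ZMod 2) ∈ K.cycles 0 := Submodule.mem_top
  rw [h, Submodule.mem_bot, Finsupp.single_eq_zero] at this
  exact one_ne_zero this

theorem nontrivial_homology_succ_iff [Fintype V] [DecidableEq V] {n : ℕ}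
    (hK : K.HasDimension (n + 1)) :
    Nontrivial (K.Homology (n + 1)) ↔ ∃ c, K.IsSimplicialCycle (n + 1) c ∧ c ≠ 0 := by
  classical
  rw [nontrivial_homology_iff_cycles hK, Submodule.ne_bot_iff]
  constructor
  · rintro ⟨f, hf, hne⟩
    let c : Finset V → ZMod 2 := fun σ => if h : σ ∈ K ∧ σ.card = n + 2 then f ⟨σ, h⟩ else 0
    have hc : ∀ σ, c σ ≠ 0 → σ ∈ K ∧ σ.card = n + 2 := fun σ h => by
      by_contra h'
      exact h (dif_neg h')
    have hcf : ∀ σ : K.Simplex (n + 1), f σ = c σ.1 := fun σ =>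
      (dif_pos (show σ.1 ∈ K ∧ σ.1.card = n + 2 from σ.2) : c σ.1 = _).symm
    refine ⟨c, ⟨hc, fun ρ => ?_⟩, fun h => hne (Finsupp.ext fun σ => ?_)⟩
    · by_cases hρ : ρ ∈ K ∧ ρ.card = n + 1
      · rw [← boundary_apply hc f hcf ⟨ρ, hρ⟩, show K.boundary n f = 0 from hf]
        rfl
      · refine Finset.sum_eq_zero fun y hy => ?_
        by_contra h
        obtain ⟨h1, h2⟩ := hc _ h
        rw [Finset.card_insert_of_notMem (Finset.mem_compl.1 hy)] at h2
        exact hρ ⟨mem_of_subset h1 (Finset.subset_insert _ _) (Finset.card_pos.1 (by omega)),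
          by omega⟩
    · rw [hcf, h]
      rfl
  · rintro ⟨c, hc, hne⟩
    let f : K.Simplex (n + 1) →₀ ZMod 2 := Finsupp.equivFunOnFinite.symm fun σ => c σ.1
    refine ⟨f, ?_, fun h => hne (funext fun σ => ?_)⟩
    · change K.boundary n f = 0
      ext τ
      rw [boundary_apply hc.1 f (fun _ => rfl) τ, hc.2]
      rfl
    · by_contra h'
      exact h' (DFunLike.congr_fun h (⟨σ, hc.1 σ h'⟩ : K.Simplex (n + 1)))

/-- If the top homology vanishes, every top-dimensional cochain is a coboundary. -/
theorem exists_eq_sum_erase [DecidableEq V] {n : ℕ} (hK : K.HasDimension (n + 1))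
    (hH : ¬ Nontrivial (K.Homology (n + 1))) (f : Finset V → ZMod 2) :
    ∃ g : Finset V → ZMod 2, ∀ σ ∈ K, σ.card = n + 2 → f σ = ∑ x ∈ σ, g (σ.erase x) := by
  classical
  rw [nontrivial_homology_iff_cycles hK, not_not] at hH
  -- The boundary is injective over a field, so it has a left inverse `l`. With `F` the linear
  -- extension of `f`, we get `F = (F ∘ l) ∘ ∂`, and `g` is `F ∘ l` on basis elements.
  obtain ⟨l, hl⟩ := (K.boundary n).exists_leftInverse_of_injective hH
  let F : (K.Simplex (n + 1) →₀ ZMod 2) →ₗ[ZMod 2] ZMod 2 :=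
    Finsupp.linearCombination (ZMod 2) fun σ => f σ.1
  refine ⟨fun τ => if h : τ ∈ K ∧ τ.card = n + 1 then F (l (Finsupp.single ⟨τ, h⟩ 1)) else 0,
    fun σ h1 h2 => ?_⟩
  have h3 : f σ = F (l (K.boundary n (Finsupp.single ⟨σ, h1, h2⟩ 1))) := by
    rw [← LinearMap.comp_apply l, hl]
    simp [F]
  rw [h3, boundary, Finsupp.linearCombination_single, one_smul, map_sum, map_sum]
  symm
  refine Finset.sum_bij (fun x hx => ⟨σ.erase x, mem_of_subset h1 (Finset.erase_subset _ _)
    (Finset.card_pos.1 (by rw [Finset.card_erase_of_mem hx]; omega)),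
      by rw [Finset.card_erase_of_mem hx]; omega⟩) ?_ ?_ ?_ ?_
  · exact fun x hx => Simplex.mem_facets.2 (Finset.erase_subset _ _)
  · intro x hx y hy e
    exact Finset.erase_injOn _ hx hy (congrArg Subtype.val e)
  · intro τ hτ
    obtain ⟨x, hx, hx'⟩ := Finset.exists_of_ssubset (Finset.ssubset_iff_subset_ne.2
      ⟨Simplex.mem_facets.1 hτ, fun e => by have := τ.2.2; rw [e] at this; exact absurd (h2.symm.trans this) (by omega)⟩)
    refine ⟨x, hx, Subtype.ext (Finset.eq_of_subset_of_card_le ?_ ?_).symm⟩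
    · exact fun z hz => Finset.mem_erase.2 ⟨fun e => hx' (e ▸ hz), Simplex.mem_facets.1 hτ hz⟩
    · rw [Finset.card_erase_of_mem hx, τ.2.2]
      exact Nat.sub_le_of_le_add h2.le
  · exact fun x hx => dif_pos _

end AbstractSimplicialComplex

/-! ### The octahedralization of a complex without top homology -/

namespace AbstractSimplicialComplex

variable {V : Type*} {K : AbstractSimplicialComplex V}

theorem mem_octahedralization [DecidableEq V] {s : Finset (V × Bool)} :
    s ∈ K.octahedralization ↔ Set.InjOn Prod.fst (s : Set (V × Bool)) ∧ s.image Prod.fst ∈ K := by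
  change (_ ∧ _) ↔ _
  convert Iff.rfl

/-- The ranking of `V × {±1}` in which `(v, -1)` immediately precedes `(v, 1)`. -/
def octRank (ρ : V → ℕ) (p : V × Bool) : ℕ := 2 * ρ p.1 + p.2.toNat

theorem octRank_lt_iff {ρ : V → ℕ} (hρ : Function.Injective ρ) {p q : V × Bool} (h : p.1 ≠ q.1) :
    octRank ρ p < octRank ρ q ↔ ρ p.1 < ρ q.1 := by
  have h1 := hρ.ne h
  have h2 := p.2.toNat_le
  have h3 := q.2.toNat_le
  unfold octRank
  omega

theorem octRank_injective {ρ : V → ℕ} (hρ : Function.Injective ρ) :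
    Function.Injective (octRank ρ) := by
  rintro ⟨v, b⟩ ⟨w, b'⟩ h
  have h2 := b.toNat_le
  have h3 := b'.toNat_le
  unfold octRank at h
  dsimp only at h
  obtain rfl : v = w := hρ (by omega)
  cases b <;> cases b' <;> simp_all

/-- Given `τ`, whether disjoint lifts alternate with `τ` only depends on their projections. -/
theorem alternating_eq_of_disjoint [DecidableEq V] {ρ : V → ℕ} (hρ : Function.Injective ρ)
    {σ τ : Finset (V × Bool)} (hσ : Set.InjOn Prod.fst (σ : Set (V × Bool))) (h : Disjoint σ τ) :
    alternating (octRank ρ) σ τ = alternating (octRank ρ)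
      ((σ.image Prod.fst).image fun v => (v, !decide ((v, true) ∈ τ))) τ := by
  -- `θ` makes the signs positive away from the projection of `τ`. Both lifts of a vertex can occur
  -- in `σ ∪ τ` only over that projection, where `θ` moves nothing; so `θ` preserves the order on `σ
  -- ∪ τ`.
  let θ : V × Bool → V × Bool := fun p => if p.1 ∈ τ.image Prod.fst then p else (p.1, true)
  have hfst : ∀ p, (θ p).1 = p.1 := fun p => by
    simp only [θ]
    split_ifs <;> rfl
  have hcase : ∀ p ∈ σ ∪ τ, ∀ q ∈ σ ∪ τ, p.1 = q.1 → p = q ∨ (θ p = p ∧ θ q = q) := by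
    intro p hp q hq e
    by_cases hpτ : p.1 ∈ τ.image Prod.fst
    · exact Or.inr ⟨if_pos hpτ, if_pos (e ▸ hpτ)⟩
    · left
      refine hσ ?_ ?_ e
      · exact (Finset.mem_union.1 hp).resolve_right fun h' => hpτ (Finset.mem_image_of_mem _ h')
      · refine (Finset.mem_union.1 hq).resolve_right fun h' => hpτ ?_
        rw [e]
        exact Finset.mem_image_of_mem _ h'
  have e1 : σ.image θ = (σ.image Prod.fst).image fun v => (v, !decide ((v, true) ∈ τ)) := by
    rw [Finset.image_image]
    refine Finset.image_congr ?_
    rintro ⟨v, b⟩ hp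
    have hp' : (v, b) ∉ τ := Finset.disjoint_left.1 h hp
    by_cases hv : v ∈ τ.image Prod.fst
    · obtain ⟨⟨w, b'⟩, hw, rfl⟩ := Finset.mem_image.1 hv
      simp only [θ, Function.comp]
      rw [if_pos hv]
      dsimp only at hp'
      cases b <;> cases b' <;> simp_all
    · have : (v, true) ∉ τ := fun h' => hv (Finset.mem_image_of_mem Prod.fst h')
      simp only [θ, Function.comp]
      rw [if_neg hv]
      simp [this]
  have e2 : τ.image θ = τ := by
    conv_rhs => rw [← Finset.image_id (s := τ)]
    refine Finset.image_congr fun p hp => ?_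
    simp only [θ]
    rw [if_pos (Finset.mem_image_of_mem _ hp)]
    rfl
  rw [← e1]
  conv_rhs => rw [← e2]
  refine (alternating_image ?_ ?_).symm
  · intro p hp q hq e
    have e' : p.1 = q.1 := by rw [← hfst p, ← hfst q, e]
    rcases hcase p hp q hq e' with h' | ⟨h1, h2⟩
    · exact h'
    · rw [← h1, ← h2, e]
  · intro p hp q hq
    by_cases e : p.1 = q.1
    · rcases hcase p hp q hq e with rfl | ⟨h1, h2⟩
      · simp
      · rw [h1, h2]
    · rw [octRank_lt_iff hρ e, octRank_lt_iff hρ (by rwa [hfst, hfst]), hfst, hfst]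

theorem image_fst_erase [DecidableEq V] {σ : Finset (V × Bool)}
    (hσ : Set.InjOn Prod.fst (σ : Set (V × Bool))) {x : V × Bool} (hx : x ∈ σ) :
    (σ.erase x).image Prod.fst = (σ.image Prod.fst).erase x.1 := by
  ext v
  simp only [Finset.mem_image, Finset.mem_erase]
  constructor
  · rintro ⟨p, ⟨hne, hp⟩, rfl⟩
    exact ⟨fun e => hne (hσ hp hx e), p, hp, rfl⟩
  · rintro ⟨hne, p, hp, rfl⟩
    exact ⟨p, ⟨fun e => hne (e ▸ rfl), hp⟩, rfl⟩

theorem card_le_of_mem_octahedralization {d : ℕ} (hK : K.HasDimension d) {σ : Finset (V × Bool)}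
    (h : σ ∈ K.octahedralization) : σ.card ≤ d + 1 := by
  classical
  rw [mem_octahedralization] at h
  rw [← Finset.card_image_of_injOn h.1]
  exact hK.2 _ h.2

/-- If the top homology of `K` vanishes, so does the top van Kampen obstruction of `OK`. -/
theorem not_isObstructor_octahedralization [Finite V] {n : ℕ} (hK : K.HasDimension (n + 1))
    (hH : ¬ Nontrivial (K.Homology (n + 1))) :
    ¬ K.octahedralization.IsObstructor (2 * (n + 1)) := by
  classical
  obtain ⟨ρ, hρ⟩ : ∃ ρ : V → ℕ, Function.Injective ρ :=
    ⟨_, Fin.val_injective.comp (Finite.equivFin V).injective⟩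
  let r := octRank ρ
  -- For each `τ`, alternation with `τ` descends to a top cochain of `K`, and `g τ` is a primitive
  -- of it.
  choose g hg using fun τ : Finset (V × Bool) => exists_eq_sum_erase hK hH
    fun ω => alternating r (ω.image fun v => (v, !decide ((v, true) ∈ τ))) τ
  have key : ∀ σ τ : Finset (V × Bool), σ ∈ K.octahedralization → Disjoint σ τ →
      σ.card = n + 2 →
      alternating r σ τ = ∑ x ∈ σ, g τ ((σ.erase x).image Prod.fst) := by
    intro σ τ hσ h hc
    rw [mem_octahedralization] at hσ
    rw [alternating_eq_of_disjoint hρ hσ.1 h, hg τ _ hσ.2 (by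
      rw [Finset.card_image_of_injOn hσ.1, hc]), Finset.sum_image hσ.1]
    exact Finset.sum_congr rfl fun x hx => by rw [image_fst_erase hσ.1 hx]
  change ¬ K.octahedralization.IsObstructor (2 * n + 1 + 1)
  rw [not_isObstructor_succ_iff (octRank_injective hρ)]
  -- The primitive uses `g` of the top-dimensional factor, evaluated on the projection of the other
  -- one. The two branches exclude each other and are exchanged by the swap, which gives invariance.
  refine ⟨fun q => if q.1.card = n + 1 ∧ q.2.card = n + 2 then g q.2 (q.1.image Prod.fst) else
    if q.2.card = n + 1 ∧ q.1.card = n + 2 then g q.1 (q.2.image Prod.fst) else 0, ?_, ?_, ?_⟩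
  · rintro ⟨σ, τ⟩
    dsimp only [Prod.swap]
    by_cases h1 : σ.card = n + 1 ∧ τ.card = n + 2
    · rw [if_neg (by omega), if_pos h1, if_pos h1]
    · by_cases h2 : τ.card = n + 1 ∧ σ.card = n + 2
      · rw [if_pos h2, if_neg h1, if_pos h2]
      · simp only [h1, h2, if_false]
  · rintro ⟨σ, τ⟩ (h | h)
    · dsimp only at h
      subst h
      simp
    · dsimp only at h
      subst h
      simp
  · rintro ⟨⟨σ, τ⟩, h1, h2, h3, h4⟩
    have c1 := card_le_of_mem_octahedralization hK h1
    have c2 := card_le_of_mem_octahedralization hK h2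
    dsimp only at h1 h2 h3 h4 c1 c2 ⊢
    -- A `2d`-cell has `2 (d + 1)` vertices and each factor has at most `d + 1`, so both factors are
    -- top-dimensional.
    rw [key σ τ h1 h3 (by omega), key τ σ h2 h3.symm (by omega)]
    congr 1
    · refine Finset.sum_congr rfl fun x hx => ?_
      have := Finset.card_erase_add_one hx
      rw [if_pos (by omega)]
    · refine Finset.sum_congr rfl fun x hx => ?_
      have := Finset.card_erase_add_one hx
      rw [if_neg (by omega), if_pos (by omega)]

end AbstractSimplicialComplex

/-! ### The octahedralization of a flag complex with top homology -/

namespace AbstractSimplicialComplex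

variable {V : Type*} {K : AbstractSimplicialComplex V}

/-- Summation by parts: coboundary and boundary are adjoint, by counting flags of a set and a
codimension-one subset. -/
theorem sum_mul_sum_erase {α : Type*} [Fintype α] [DecidableEq α] (c F : Finset α → ZMod 2) :
    ∑ σ, c σ * ∑ x ∈ σ, F (σ.erase x) = ∑ ρ, F ρ * ∑ y ∈ ρᶜ, c (insert y ρ) := by
  simp only [Finset.mul_sum]
  rw [Finset.sum_sigma', Finset.sum_sigma']
  refine Finset.sum_nbij' (fun a => ⟨a.1.erase a.2, a.2⟩) (fun a => ⟨insert a.2 a.1, a.2⟩) ?_ ?_ ?_ ?_ ?_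
  · rintro ⟨σ, x⟩ h
    simp
  · rintro ⟨σ, x⟩ h
    simp
  · rintro ⟨σ, x⟩ h
    simp only [Finset.mem_sigma, Finset.mem_univ, true_and] at h
    simp [Finset.insert_erase h]
  · rintro ⟨σ, x⟩ h
    simp only [Finset.mem_sigma, Finset.mem_univ, true_and, Finset.mem_compl] at h
    simp [Finset.erase_insert h]
  · rintro ⟨σ, x⟩ h
    simp only [Finset.mem_sigma, Finset.mem_univ, true_and] at h
    simp [Finset.insert_erase h, mul_comm]

section

variable [DecidableEq V]

/-- `σ` is a lift to `OK` of a simplex in the support of `c`, with positive signs off `Δ`. -/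
structure IsLift (c : Finset V → ZMod 2) (Δ : Finset V) (σ : Finset (V × Bool)) : Prop where
  injOn : Set.InjOn Prod.fst (σ : Set (V × Bool))
  ne_zero : c (σ.image Prod.fst) ≠ 0
  sign : ∀ p ∈ σ, p.1 ∉ Δ → p.2 = true

/-- Pairs of disjoint lifts whose projections cover `Δ`. -/
structure IsCoveringPair (c : Finset V → ZMod 2) (Δ : Finset V) (σ τ : Finset (V × Bool)) :
    Prop where
  left : IsLift c Δ σ
  right : IsLift c Δ τ
  disjoint : Disjoint σ τ
  subset : Δ ⊆ σ.image Prod.fst ∪ τ.image Prod.fst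

variable {c : Finset V → ZMod 2} {Δ : Finset V}

theorem IsCoveringPair.swap {σ τ : Finset (V × Bool)} (h : IsCoveringPair c Δ σ τ) :
    IsCoveringPair c Δ τ σ :=
  ⟨h.right, h.left, h.disjoint.symm, Finset.union_comm (σ.image Prod.fst) _ ▸ h.subset⟩

/-- Separates the conditions on the vertex below `y` from those on its sign, so that extensions can
be counted by counting, for each vertex of `K`, the admissible signs. -/
theorem isCoveringPair_insert_iff {ρ τ : Finset (V × Bool)} (hρ : Set.InjOn Prod.fst (ρ : Set (V × Bool)))
    (hs : ∀ p ∈ ρ, p.1 ∉ Δ → p.2 = true) (hτ : IsLift c Δ τ) (hd : Disjoint ρ τ) {y : V × Bool} :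
    y ∉ ρ ∧ IsCoveringPair c Δ (insert y ρ) τ ↔
      y.1 ∉ ρ.image Prod.fst ∧ c (insert y.1 (ρ.image Prod.fst)) ≠ 0 ∧ (y.1 ∉ Δ → y.2 = true) ∧
        y ∉ τ ∧ Δ ⊆ insert y.1 (ρ.image Prod.fst ∪ τ.image Prod.fst) := by
  constructor
  · rintro ⟨hy, h⟩
    have h1 := h.left.ne_zero
    have h2 := h.subset
    rw [Finset.image_insert] at h1 h2
    rw [Finset.insert_union] at h2
    refine ⟨fun h' => ?_, h1, h.left.sign y (Finset.mem_insert_self _ _),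
      Finset.disjoint_left.1 h.disjoint (Finset.mem_insert_self _ _), h2⟩
    obtain ⟨p, hp, e⟩ := Finset.mem_image.1 h'
    have := h.left.injOn (Finset.mem_coe.2 (Finset.mem_insert_of_mem hp))
      (Finset.mem_coe.2 (Finset.mem_insert_self _ _)) e
    exact hy (this ▸ hp)
  · rintro ⟨h1, h2, h3, h4, h5⟩
    refine ⟨fun h => h1 (Finset.mem_image_of_mem _ h), ⟨?_, ?_, ?_⟩, hτ, ?_, ?_⟩
    · rw [Finset.coe_insert, Set.injOn_insert]
      · refine ⟨hρ, fun h => h1 ?_⟩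
        rw [← Finset.mem_coe, Finset.coe_image]
        exact h
      · exact fun h => h1 (Finset.mem_image_of_mem _ h)
    · rwa [Finset.image_insert]
    · intro p hp
      rcases Finset.mem_insert.1 hp with rfl | hp
      · exact h3
      · exact hs p hp
    · rw [Finset.disjoint_insert_left]
      exact ⟨h4, hd⟩
    · rwa [Finset.image_insert, Finset.insert_union]

/-- For fixed `τ`, the covering pairs `(σ, τ)` form a cycle. -/
theorem sum_isCoveringPair_insert [Fintype V] {d : ℕ} (hK : K.HasDimension d)
    (hflag : ∀ σ : Finset V, σ.Nonempty → (∀ a ∈ σ, ∀ b ∈ σ, {a, b} ∈ K) → σ ∈ K)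
    (hc : K.IsSimplicialCycle d c) (hΔ : c Δ ≠ 0) (ρ τ : Finset (V × Bool))
    [DecidablePred fun y => IsCoveringPair c Δ (insert y ρ) τ] :
    ∑ y ∈ ρᶜ, (if IsCoveringPair c Δ (insert y ρ) τ then (1 : ZMod 2) else 0) = 0 := by
  classical
  by_cases hex : ∃ y, y ∉ ρ ∧ IsCoveringPair c Δ (insert y ρ) τ
  swap
  · refine Finset.sum_eq_zero fun y hy => if_neg fun h => hex ⟨y, by simpa using hy, h⟩
  obtain ⟨y₀, hy₀, h₀⟩ := hex
  have hτ := h₀.right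
  have hρ : Set.InjOn Prod.fst (ρ : Set (V × Bool)) := h₀.left.injOn.mono (by simp)
  have hs : ∀ p ∈ ρ, p.1 ∉ Δ → p.2 = true := fun p hp => h₀.left.sign p (by simp [hp])
  have hd : Disjoint ρ τ := h₀.disjoint.mono_left (by simp)
  have hiff := fun y => isCoveringPair_insert_iff hρ hs hτ hd (y := y)
  -- If `Δ` is already covered, each vertex `w` extending the projection of `ρ` to a simplex in the
  -- support of `c` has exactly one admissible sign, and the count is the cycle condition of `c`.
  -- Over `Δ` that sign is opposite to the one in `τ`; off `Δ` it is positive.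
  by_cases hcov : Δ ⊆ ρ.image Prod.fst ∪ τ.image Prod.fst
  · refine Eq.trans ?_ (hc.sum_insert (ρ.image Prod.fst))
    refine Finset.sum_bij_ne_zero (fun y _ _ => y.1) ?_ ?_ ?_ ?_
    · intro y hy h
      simpa using ((hiff y).1 ⟨by simpa using hy, (ite_ne_right_iff.1 h).1⟩).1
    · rintro ⟨v, b⟩ hy h ⟨w, b'⟩ hy' h' e
      obtain rfl : v = w := e
      obtain ⟨k1, -, k3, k4, -⟩ := (hiff _).1 ⟨by simpa using hy, (ite_ne_right_iff.1 h).1⟩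
      obtain ⟨k1', -, k3', k4', -⟩ := (hiff _).1 ⟨by simpa using hy', (ite_ne_right_iff.1 h').1⟩
      by_cases hv : v ∈ Δ
      · obtain ⟨⟨w, b''⟩, hw, rfl⟩ :=
          Finset.mem_image.1 ((Finset.mem_union.1 (hcov hv)).resolve_left k1)
        dsimp only at k4 k4'
        cases b <;> cases b' <;> cases b'' <;> simp_all
      · rw [show b = true from k3 hv, show b' = true from k3' hv]
    · intro w hw hcw
      rw [Finset.mem_compl] at hw
      have hsub : Δ ⊆ insert w (ρ.image Prod.fst ∪ τ.image Prod.fst) :=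
        hcov.trans (Finset.subset_insert _ _)
      have hcase : ∃ b, (w ∉ Δ → b = true) ∧ (w, b) ∉ τ := by
        by_cases hwτ : w ∈ τ.image Prod.fst
        · obtain ⟨⟨w, b⟩, hwb, rfl⟩ := Finset.mem_image.1 hwτ
          refine ⟨!b, fun hwΔ => ?_, fun h' => ?_⟩
          · exfalso
            -- A vertex `w` off `Δ` cannot lie under `τ`: it would span an edge with every vertex of
            -- `Δ`, through the extended projection of `ρ` or through that of `τ`, and flagness
            -- would yield a simplex of dimension `d + 1`.
            have hmem : insert w Δ ∈ K := by
              refine hflag _ (Finset.insert_nonempty _ _) ?_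
              have h1 := (hc.1 Δ hΔ).1
              have h2 := (hc.1 _ hcw).1
              have h3 := (hc.1 _ hτ.ne_zero).1
              have hw2 : ∀ a ∈ Δ, {w, a} ∈ K := by
                intro a ha
                rcases Finset.mem_union.1 (hcov ha) with ha | ha
                · refine mem_of_subset h2 ?_ (Finset.insert_nonempty _ _)
                  exact Finset.insert_subset (Finset.mem_insert_self _ _)
                    (Finset.singleton_subset_iff.2 (Finset.mem_insert_of_mem ha))
                · refine mem_of_subset h3 ?_ (Finset.insert_nonempty _ _)
                  exact Finset.insert_subset hwτ (Finset.singleton_subset_iff.2 ha)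
              intro a ha b hb
              rcases Finset.mem_insert.1 ha with ha' | ha' <;>
                rcases Finset.mem_insert.1 hb with hb' | hb'
              · rw [ha', hb', Finset.pair_eq_singleton]
                exact K.singleton_mem _
              · exact ha' ▸ hw2 b hb'
              · rw [Finset.pair_comm, hb']
                exact hw2 a ha'
              · exact mem_of_subset h1
                  (Finset.insert_subset ha' (Finset.singleton_subset_iff.2 hb'))
                  (Finset.insert_nonempty _ _)
            have := hK.2 _ hmem
            rw [Finset.card_insert_of_notMem hwΔ, (hc.1 Δ hΔ).2] at this
            omega
          · have := hτ.injOn (Finset.mem_coe.2 hwb) (Finset.mem_coe.2 h') rfl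
            simp at this
        · exact ⟨true, fun _ => rfl, fun h' => hwτ (Finset.mem_image_of_mem Prod.fst h')⟩
      obtain ⟨b, hb1, hb2⟩ := hcase
      obtain ⟨k1, k2⟩ := (hiff (w, b)).2 ⟨hw, hcw, hb1, hb2, hsub⟩
      exact ⟨(w, b), by simpa using k1, by simp [k2], rfl⟩
    · intro y hy h
      obtain ⟨-, k2, -⟩ := (hiff y).1 ⟨by simpa using hy, (ite_ne_right_iff.1 h).1⟩
      rw [if_pos (ite_ne_right_iff.1 h).1]
      exact (show ∀ a : ZMod 2, a ≠ 0 → 1 = a by decide) _ k2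
  -- An uncovered vertex `v` of `Δ` must be the one that `y` supplies. Both of its signs are then
  -- allowed, and the two extensions cancel.
  · obtain ⟨v, hv, hv'⟩ := Finset.not_subset.1 hcov
    rw [← Finset.sum_filter]
    have hmem : ∀ y, y ∈ ρᶜ.filter (fun y => IsCoveringPair c Δ (insert y ρ) τ) ↔
        y.1 = v ∧ c (insert v (ρ.image Prod.fst)) ≠ 0 ∧
          Δ ⊆ insert v (ρ.image Prod.fst ∪ τ.image Prod.fst) := by
      intro y
      rw [Finset.mem_filter, Finset.mem_compl, hiff]
      constructor
      · rintro ⟨-, k2, -, -, k5⟩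
        obtain rfl : v = y.1 := (Finset.mem_insert.1 (k5 hv)).resolve_right hv'
        exact ⟨rfl, k2, k5⟩
      · rintro ⟨rfl, k2, k5⟩
        rw [Finset.mem_union, not_or] at hv'
        exact ⟨hv'.1, k2, fun h => absurd hv h,
          fun h => hv'.2 (Finset.mem_image_of_mem Prod.fst h), k5⟩
    refine Finset.sum_involution (fun y _ => (y.1, !y.2)) ?_ ?_ ?_ ?_
    · exact fun _ _ => CharTwo.add_self_eq_zero _
    · rintro ⟨w, b⟩ - - e
      simp at e
    · intro y hy
      rw [hmem] at hy ⊢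
      exact hy
    · rintro ⟨w, b⟩ -
      simp

/-- Change the sign of the vertex `v`. -/
def flipSign (v : V) (p : V × Bool) : V × Bool := if p.1 = v then (p.1, !p.2) else p

@[simp] theorem flipSign_fst (v : V) (p : V × Bool) : (flipSign v p).1 = p.1 := by
  unfold flipSign
  split_ifs <;> rfl

theorem flipSign_flipSign (v : V) (p : V × Bool) : flipSign v (flipSign v p) = p := by
  obtain ⟨w, b⟩ := p
  by_cases h : w = v <;> simp [flipSign, h]

theorem flipSign_injective (v : V) : Function.Injective (flipSign v) :=
  Function.LeftInverse.injective (flipSign_flipSign v)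

theorem image_fst_image_flipSign (v : V) (σ : Finset (V × Bool)) :
    (σ.image (flipSign v)).image Prod.fst = σ.image Prod.fst := by
  rw [Finset.image_image]
  exact Finset.image_congr fun p _ => flipSign_fst v p

theorem image_flipSign_image_flipSign (v : V) (σ : Finset (V × Bool)) :
    (σ.image (flipSign v)).image (flipSign v) = σ := by
  rw [Finset.image_image]
  conv_rhs => rw [← Finset.image_id (s := σ)]
  exact Finset.image_congr fun p _ => flipSign_flipSign v p

theorem IsLift.image_flipSign {v : V} (hv : v ∈ Δ) {σ : Finset (V × Bool)} (h : IsLift c Δ σ) :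
    IsLift c Δ (σ.image (flipSign v)) := by
  refine ⟨?_, ?_, ?_⟩
  · rintro p hp q hq e
    obtain ⟨p, hp', rfl⟩ := Finset.mem_image.1 (Finset.mem_coe.1 hp)
    obtain ⟨q, hq', rfl⟩ := Finset.mem_image.1 (Finset.mem_coe.1 hq)
    rw [flipSign_fst, flipSign_fst] at e
    rw [h.injOn hp' hq' e]
  · rw [image_fst_image_flipSign]
    exact h.ne_zero
  · intro p hp hpΔ
    obtain ⟨p, hp', rfl⟩ := Finset.mem_image.1 hp
    rw [flipSign_fst] at hpΔ
    have : flipSign v p = p := if_neg fun (e : p.1 = v) => hpΔ (e ▸ hv)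
    rw [this]
    exact h.sign p hp' hpΔ

theorem IsCoveringPair.image_flipSign {v : V} (hv : v ∈ Δ) {σ τ : Finset (V × Bool)}
    (h : IsCoveringPair c Δ σ τ) :
    IsCoveringPair c Δ (σ.image (flipSign v)) (τ.image (flipSign v)) := by
  refine ⟨h.left.image_flipSign hv, h.right.image_flipSign hv,
    (Finset.disjoint_image (flipSign_injective v)).2 h.disjoint, ?_⟩
  rw [image_fst_image_flipSign, image_fst_image_flipSign]
  exact h.subset

/-- At most one lift of `v` is present, so its sign has no effect on the order. -/
theorem alternating_image_flipSign {ρ : V → ℕ} (hρ : Function.Injective ρ) {v : V}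
    {σ τ : Finset (V × Bool)} (h : IsCoveringPair c Δ σ τ)
    (hv : v ∉ σ.image Prod.fst ∩ τ.image Prod.fst) :
    alternating (octRank ρ) (σ.image (flipSign v)) (τ.image (flipSign v)) =
      alternating (octRank ρ) σ τ := by
  refine alternating_image (flipSign_injective v).injOn fun p hp q hq => ?_
  by_cases e : p.1 = q.1
  · by_cases hpv : p.1 = v
    · have : p = q := by
        rcases Finset.mem_union.1 hp with hp | hp <;> rcases Finset.mem_union.1 hq with hq | hq
        · exact h.left.injOn hp hq e
        · refine absurd (Finset.mem_inter.2 ⟨?_, ?_⟩) hv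
          · exact hpv ▸ Finset.mem_image_of_mem _ hp
          · exact hpv ▸ e ▸ Finset.mem_image_of_mem _ hq
        · refine absurd (Finset.mem_inter.2 ⟨?_, ?_⟩) hv
          · exact hpv ▸ e ▸ Finset.mem_image_of_mem _ hq
          · exact hpv ▸ Finset.mem_image_of_mem _ hp
        · exact h.right.injOn hp hq e
      rw [this]
      simp
    · rw [show flipSign v p = p from if_neg hpv, show flipSign v q = q from if_neg (e ▸ hpv)]
  · rw [octRank_lt_iff hρ e, octRank_lt_iff hρ (by simpa using e), flipSign_fst, flipSign_fst]

/-- Every smaller vertex of `Δ` contributes both of its lifts, hence zero modulo 2, to the position;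
only the fibre over `v` counts. -/
theorem positionColor_octRank {ρ : V → ℕ} (hρ : Function.Injective ρ)
    {σ τ : Finset (V × Bool)} (h : σ ∪ τ = Δ ×ˢ Finset.univ) {v : V} (hv : v ∈ Δ) (b : Bool) :
    positionColor (octRank ρ) σ τ (v, b) =
      (if b = true then 1 else 0) + if (v, b) ∈ τ then 1 else 0 := by
  unfold positionColor
  congr 1
  rw [h, Finset.card_filter, Finset.sum_product, Nat.cast_sum, Finset.sum_eq_single_of_mem v hv]
  · cases b <;> simp [octRank]
  · intro w _ hw
    have h1 : octRank ρ (w, true) < octRank ρ (v, b) ↔ ρ w < ρ v := octRank_lt_iff hρ hw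
    have h2 : octRank ρ (w, false) < octRank ρ (v, b) ↔ ρ w < ρ v := octRank_lt_iff hρ hw
    simp only [Fintype.sum_bool, h1, h2, Nat.cast_add]
    exact CharTwo.add_self_eq_zero _

/-- The only covering pair over `(Δ, Δ)` that alternates, starting in `σ`, consists of the negative
and the positive lift of `Δ`. -/
theorem alternating_eq_ite {ρ : V → ℕ} (hρ : Function.Injective ρ)
    {σ τ : Finset (V × Bool)} (hd : Disjoint σ τ) (h : σ ∪ τ = Δ ×ˢ Finset.univ) :
    alternating (octRank ρ) σ τ =
      if (σ, τ) = (Δ ×ˢ {false}, Δ ×ˢ {true}) then 1 else 0 := by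
  split_ifs with he
  · simp only [Prod.mk.injEq] at he
    refine Finset.prod_eq_one ?_
    rintro ⟨v, b⟩ hp
    rw [h] at hp
    have hv := (Finset.mem_product.1 hp).1
    rw [positionColor_octRank hρ h hv, he.2]
    dsimp only at hv
    cases b <;> simp [hv]
    decide
  · by_contra hne
    apply he
    unfold alternating at hne
    rw [← Ne, Finset.prod_ne_zero_iff] at hne
    -- A nonzero product forces every color to be zero, so the positive lifts lie in `τ` and the
    -- negative ones do not.
    have key : ∀ v ∈ Δ, ∀ b : Bool, (v, b) ∈ τ ↔ b = true := by
      intro v hv b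
      have := hne (v, b) (by rw [h]; simp [hv])
      rw [positionColor_octRank hρ h hv] at this
      by_cases hb : b = true <;> by_cases hτ : (v, b) ∈ τ <;> simp only [hb] at this ⊢ <;>
        simp_all
      all_goals exact this (by decide)
    have hmem : ∀ p : V × Bool, p ∈ σ ∨ p ∈ τ ↔ p.1 ∈ Δ := fun p => by
      rw [← Finset.mem_union, h]
      simp
    rw [Prod.mk.injEq]
    constructor
    · ext ⟨v, b⟩
      simp only [Finset.mem_product, Finset.mem_singleton]
      constructor
      · intro hp
        have hv := (hmem _).1 (Or.inl hp)
        refine ⟨hv, ?_⟩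
        simpa using mt (key v hv b).2 (Finset.disjoint_left.1 hd hp)
      · rintro ⟨hv, rfl⟩
        exact ((hmem (v, false)).2 hv).resolve_right fun h' => by simpa using (key v hv _).1 h'
    · ext ⟨v, b⟩
      simp only [Finset.mem_product, Finset.mem_singleton]
      constructor
      · intro hp
        have hv := (hmem _).1 (Or.inr hp)
        exact ⟨hv, (key v hv b).1 hp⟩
      · rintro ⟨hv, hb⟩
        exact (key v hv b).2 hb

end

end AbstractSimplicialComplex

/-! ### Evaluating the obstruction on the cycle of covering pairs -/

namespace AbstractSimplicialComplex

variable {V : Type*} {K : AbstractSimplicialComplex V}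

theorem IsLift.mem_octahedralization [Fintype V] [DecidableEq V] {d : ℕ} {c : Finset V → ZMod 2}
    (hc : K.IsSimplicialCycle d c) {Δ : Finset V} {σ : Finset (V × Bool)} (h : IsLift c Δ σ) :
    σ ∈ K.octahedralization ∧ σ.card = d + 1 := by
  obtain ⟨h1, h2⟩ := hc.1 _ h.ne_zero
  rw [Finset.card_image_of_injOn h.injOn] at h2
  exact ⟨AbstractSimplicialComplex.mem_octahedralization.2 ⟨h.injOn, h1⟩, h2⟩

/-- A simplex in the support of a cycle has two canonical lifts, which are a covering pair. -/
theorem isCoveringPair_product [DecidableEq V] {c : Finset V → ZMod 2} {Δ : Finset V}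
    (hΔ : c Δ ≠ 0) : IsCoveringPair c Δ (Δ ×ˢ {false}) (Δ ×ˢ {true}) := by
  have himg : ∀ b : Bool, (Δ ×ˢ ({b} : Finset Bool)).image Prod.fst = Δ := by
    intro b
    ext v
    simp
  have hlift : ∀ b : Bool, IsLift c Δ (Δ ×ˢ {b}) := by
    refine fun b => ⟨?_, by rwa [himg], ?_⟩
    · rintro ⟨v, b₁⟩ h₁ ⟨w, b₂⟩ h₂ e
      simp at h₁ h₂ e
      exact Prod.ext e (h₁.2.symm.trans h₂.2)
    · intro p hp hpΔ
      exact absurd (Finset.mem_product.1 hp).1 hpΔ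
  refine ⟨hlift _, hlift _, ?_, by rw [himg, himg, Finset.union_idempotent]⟩
  rw [Finset.disjoint_left]
  rintro ⟨v, b⟩ h1 h2
  simp_all

/-- Both projections contain `Δ` and have its cardinality, so they equal `Δ`; disjointness then
makes the two lifts exhaust all `2 (d + 1)` signed vertices. -/
theorem IsCoveringPair.union_eq [Fintype V] [DecidableEq V] {d : ℕ} {c : Finset V → ZMod 2}
    (hc : K.IsSimplicialCycle d c) {Δ : Finset V} (hΔ : c Δ ≠ 0) {σ τ : Finset (V × Bool)}
    (h : IsCoveringPair c Δ σ τ) (hsub : Δ ⊆ σ.image Prod.fst ∩ τ.image Prod.fst) :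
    σ ∪ τ = Δ ×ˢ Finset.univ := by
  have e : ∀ {s : Finset (V × Bool)}, IsLift c Δ s → Δ ⊆ s.image Prod.fst →
      s.image Prod.fst = Δ := fun hs hsub => (Finset.eq_of_subset_of_card_le hsub (by
    rw [(hc.1 _ hs.ne_zero).2, (hc.1 _ hΔ).2])).symm
  have e1 := e h.left (hsub.trans Finset.inter_subset_left)
  have e2 := e h.right (hsub.trans Finset.inter_subset_right)
  refine Finset.eq_of_subset_of_card_le ?_ ?_
  · intro p hp
    simp only [Finset.mem_product, Finset.mem_univ, and_true]
    rcases Finset.mem_union.1 hp with hp | hp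
    · exact e1 ▸ Finset.mem_image_of_mem _ hp
    · exact e2 ▸ Finset.mem_image_of_mem _ hp
  · rw [Finset.card_union_of_disjoint h.disjoint, (h.left.mem_octahedralization hc).2,
      (h.right.mem_octahedralization hc).2, Finset.card_product, (hc.1 _ hΔ).2]
    simp
    omega

/-- The number of alternating covering pairs is odd. -/
theorem sum_alternating_isCoveringPair [Fintype V] [DecidableEq V] {d : ℕ} {c : Finset V → ZMod 2}
    (hc : K.IsSimplicialCycle d c) {Δ : Finset V} (hΔ : c Δ ≠ 0) {ρ : V → ℕ}
    (hρ : Function.Injective ρ) [DecidablePred fun q : _ × _ => IsCoveringPair c Δ q.1 q.2] :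
    ∑ q ∈ Finset.univ.filter fun q : _ × _ => IsCoveringPair c Δ q.1 q.2,
      alternating (octRank ρ) q.1 q.2 = 1 := by
  classical
  rw [← Finset.sum_filter_add_sum_filter_not _
    fun q : Finset (V × Bool) × Finset (V × Bool) => Δ ⊆ q.1.image Prod.fst ∩ q.2.image Prod.fst]
  have h1 : ∑ q ∈ (Finset.univ.filter fun q : _ × _ => IsCoveringPair c Δ q.1 q.2).filter
      (fun q => Δ ⊆ q.1.image Prod.fst ∩ q.2.image Prod.fst),
      alternating (octRank ρ) q.1 q.2 = 1 := by
    have hval : ∀ q ∈ (Finset.univ.filter fun q : _ × _ => IsCoveringPair c Δ q.1 q.2).filter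
        (fun q => Δ ⊆ q.1.image Prod.fst ∩ q.2.image Prod.fst),
        alternating (octRank ρ) q.1 q.2 = if q = (Δ ×ˢ {false}, Δ ×ˢ {true}) then 1 else 0 := by
      intro q hq
      simp only [Finset.mem_filter, Finset.mem_univ, true_and] at hq
      exact alternating_eq_ite hρ hq.1.disjoint (hq.1.union_eq hc hΔ hq.2)
    rw [Finset.sum_congr rfl hval, Finset.sum_ite_eq', if_pos]
    simp only [Finset.mem_filter, Finset.mem_univ, true_and]
    refine ⟨isCoveringPair_product hΔ, fun v hv => ?_⟩
    simp [hv]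
  rw [h1]
  -- The vertex to be flipped is chosen as a function of the set of shared vertices alone. Flipping
  -- preserves that set, so the same vertex is chosen again and the flip is an involution.
  have hpick : ∀ D : Finset V, ∃ v, ¬ Δ ⊆ D → v ∈ Δ ∧ v ∉ D := by
    intro D
    by_cases h : Δ ⊆ D
    · obtain ⟨v, -⟩ := Finset.card_pos.1 (show 0 < Δ.card by rw [(hc.1 _ hΔ).2]; omega)
      exact ⟨v, fun h' => absurd h h'⟩
    · obtain ⟨v, h1, h2⟩ := Finset.not_subset.1 h
      exact ⟨v, fun _ => ⟨h1, h2⟩⟩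
  choose pick hpick using hpick
  let v : Finset (V × Bool) × Finset (V × Bool) → V := fun q =>
    pick (q.1.image Prod.fst ∩ q.2.image Prod.fst)
  rw [Finset.sum_involution (fun q _ => (q.1.image (flipSign (v q)), q.2.image (flipSign (v q)))),
    add_zero]
  · intro q hq
    simp only [Finset.mem_filter, Finset.mem_univ, true_and] at hq
    rw [alternating_image_flipSign hρ hq.1 (hpick _ hq.2).2]
    exact CharTwo.add_self_eq_zero _
  · rintro ⟨σ, τ⟩ hq - e
    simp only [Finset.mem_filter, Finset.mem_univ, true_and] at hq
    have hv := hpick _ hq.2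
    have key : ∀ {s : Finset (V × Bool)} {w : V}, IsLift c Δ s → w ∈ s.image Prod.fst →
        s.image (flipSign w) ≠ s := by
      intro s w hs hw e
      obtain ⟨p, hp, rfl⟩ := Finset.mem_image.1 hw
      have h1 : flipSign p.1 p ∈ s := by
        have := Finset.mem_image_of_mem (flipSign p.1) hp
        rwa [e] at this
      have h2 := hs.injOn (Finset.mem_coe.2 h1) (Finset.mem_coe.2 hp) (flipSign_fst _ _)
      have h3 := congrArg Prod.snd h2
      simp [flipSign] at h3
    rw [Prod.mk.injEq] at e
    rcases Finset.mem_union.1 (hq.1.subset hv.1) with h | h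
    · exact key hq.1.left h e.1
    · exact key hq.1.right h e.2
  · intro q hq
    simp only [Finset.mem_filter, Finset.mem_univ, true_and] at hq ⊢
    refine ⟨hq.1.image_flipSign (hpick _ hq.2).1, ?_⟩
    rw [image_fst_image_flipSign, image_fst_image_flipSign]
    exact hq.2
  · intro q hq
    simp only [v, image_fst_image_flipSign, image_flipSign_image_flipSign]

/-- If a flag complex `K` has nonzero top homology, the top van Kampen obstruction of `OK` does not
vanish. -/
theorem isObstructor_octahedralization [Fintype V] [DecidableEq V] {n : ℕ}
    (hK : K.HasDimension (n + 1))
    (hflag : ∀ σ : Finset V, σ.Nonempty → (∀ a ∈ σ, ∀ b ∈ σ, {a, b} ∈ K) → σ ∈ K)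
    {c : Finset V → ZMod 2} (hc : K.IsSimplicialCycle (n + 1) c) (hne : c ≠ 0) :
    K.octahedralization.IsObstructor (2 * (n + 1)) := by
  classical
  obtain ⟨Δ, hΔ⟩ := Function.ne_iff.1 hne
  obtain ⟨ρ, hρ⟩ : ∃ ρ : V → ℕ, Function.Injective ρ :=
    ⟨_, Fin.val_injective.comp (Finite.equivFin V).injective⟩
  change K.octahedralization.IsObstructor (2 * n + 1 + 1)
  by_contra hvk
  rw [not_isObstructor_succ_iff (octRank_injective hρ)] at hvk
  obtain ⟨h, hswap, -, hh⟩ := hvk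
  let Ω := Finset.univ.filter fun q : _ × _ => IsCoveringPair c Δ q.1 q.2
  let H : Finset (V × Bool) × Finset (V × Bool) → ZMod 2 := fun q =>
    ∑ x ∈ q.1, h (q.1.erase x, q.2)
  have h1 : ∑ q ∈ Ω, alternating (octRank ρ) q.1 q.2 = 1 :=
    sum_alternating_isCoveringPair hc hΔ hρ
  -- For fixed `τ` this pairs a coboundary in the variable `σ` with the cycle of all `σ` such that
  -- `(σ, τ)` is a covering pair.
  have h2 : ∑ q ∈ Ω, H q = 0 := by
    rw [Finset.sum_filter, Fintype.sum_prod_type_right]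
    refine Finset.sum_eq_zero fun τ _ => ?_
    have := sum_mul_sum_erase (fun σ => if IsCoveringPair c Δ σ τ then (1 : ZMod 2) else 0)
      fun σ => h (σ, τ)
    simp only [sum_isCoveringPair_insert hK hflag hc hΔ, mul_zero, Finset.sum_const_zero,
      ite_mul, one_mul, zero_mul] at this
    exact this
  -- The coboundary equation says that `alternating + H` takes equal values on a pair and its swap.
  -- The swap acts freely on `Ω`, so the sum vanishes, although `h1` and `h2` make it one.
  have h3 : ∑ q ∈ Ω, (alternating (octRank ρ) q.1 q.2 + H q) = 0 := by
    refine Finset.sum_involution (fun q _ => q.swap) ?_ ?_ ?_ ?_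
    · intro q hq
      have hq' : IsCoveringPair c Δ q.1 q.2 := (Finset.mem_filter.1 hq).2
      obtain ⟨k1, k2⟩ := hq'.left.mem_octahedralization hc
      obtain ⟨k3, k4⟩ := hq'.right.mem_octahedralization hc
      have key := hh ⟨q, k1, k3, hq'.disjoint, by omega⟩
      have e : ∑ y ∈ q.2, h (q.1, q.2.erase y) = H q.swap :=
        Finset.sum_congr rfl fun y _ => (hswap (q.1, q.2.erase y)).symm
      rw [e] at key
      rw [add_add_add_comm]
      exact (congrArg₂ (· + ·) key rfl).trans (CharTwo.add_self_eq_zero _)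
    · intro q hq _ e
      have hq' : IsCoveringPair c Δ q.1 q.2 := (Finset.mem_filter.1 hq).2
      have e' : q.2 = q.1 := congrArg Prod.fst e
      have h4 := hq'.disjoint
      rw [e', disjoint_self] at h4
      exact (nonempty_of_mem (hq'.left.mem_octahedralization hc).1).ne_empty h4
    · intro q hq
      exact Finset.mem_filter.2 ⟨Finset.mem_univ _, (Finset.mem_filter.1 hq).2.swap⟩
    · exact fun q _ => rfl
  rw [Finset.sum_add_distrib, h1, h2] at h3
  exact absurd h3 (by decide)

end AbstractSimplicialComplex

/-! ### Combinatorics of nested sets -/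

namespace CoxeterSystem

variable {B W : Type*} [Group W] {M : CoxeterMatrix B} {cs : CoxeterSystem M W}

theorem exists_adj_of_connected {T A : Finset B} (hT : (cs.diagram.induce (T : Set B)).Connected)
    {u w : B} (hu : u ∈ T) (huA : u ∈ A) (hw : w ∈ T) (hwA : w ∉ A) :
    ∃ u ∈ T, ∃ w ∈ T, u ∈ A ∧ w ∉ A ∧ cs.diagram.Adj u w := by
  obtain ⟨p⟩ := hT.preconnected ⟨u, hu⟩ ⟨w, hw⟩
  obtain ⟨d, -, h1, h2⟩ := p.exists_boundary_dart {x | x.1 ∈ A} huA hwA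
  exact ⟨d.fst.1, d.fst.2, d.snd.1, d.snd.2, h1, h2, d.adj⟩

theorem commute_of_not_adj {s t : B} (h : ¬ cs.diagram.Adj s t) :
    Commute (cs.simple s) (cs.simple t) := by
  by_cases hst : s = t
  · rw [hst]
  have h2 : M s t = 2 := by
    have h1 := M.off_diagonal s t hst
    change ¬ (2 < M s t ∨ M s t = 0) at h
    omega
  have h3 := cs.simple_mul_simple_pow s t
  rw [h2, pow_two, mul_eq_one_iff_eq_inv, mul_inv_rev, cs.inv_simple, cs.inv_simple] at h3
  exact h3

open scoped Classical in
-- The two special subgroups commute elementwise, so multiplication maps their finite product onto a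
-- subgroup containing every generator from `T ∪ T'`.
theorem IsSpherical.union {T T' : Finset B} (h : cs.IsSpherical T) (h' : cs.IsSpherical T')
    (ho : Orthogonal T T' cs) : cs.IsSpherical (T ∪ T') := by
  have hf : Finite (Subgroup.closure (cs.simple '' (T : Set B))) := h
  have hf' : Finite (Subgroup.closure (cs.simple '' (T' : Set B))) := h'
  have hcomm : ∀ (m : Subgroup.closure (cs.simple '' (T : Set B)))
      (n : Subgroup.closure (cs.simple '' (T' : Set B))), Commute m.1 n.1 := by
    have h1 : Subgroup.closure (cs.simple '' (T : Set B)) ≤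
        Subgroup.centralizer (Subgroup.closure (cs.simple '' (T' : Set B)) : Set W) := by
      rw [Subgroup.centralizer_closure, Subgroup.closure_le]
      rintro _ ⟨s, hs, rfl⟩
      rw [SetLike.mem_coe, Subgroup.mem_centralizer_iff]
      rintro _ ⟨t, ht, rfl⟩
      exact (commute_of_not_adj (ho s hs t ht).2).symm
    intro m n
    exact (Subgroup.mem_centralizer_iff.1 (h1 m.2) n.1 n.2).symm
  let φ := MonoidHom.noncommCoprod (Subgroup.closure (cs.simple '' (T : Set B))).subtype
    (Subgroup.closure (cs.simple '' (T' : Set B))).subtype hcomm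
  have hle : Subgroup.closure (cs.simple '' ((T ∪ T' : Finset B) : Set B)) ≤ φ.range := by
    rw [Subgroup.closure_le]
    rintro _ ⟨s, hs, rfl⟩
    rcases Finset.mem_union.1 (Finset.mem_coe.1 hs) with hs | hs
    · exact ⟨(⟨_, Subgroup.subset_closure ⟨s, hs, rfl⟩⟩, 1), mul_one (cs.simple s)⟩
    · exact ⟨(1, ⟨_, Subgroup.subset_closure ⟨s, hs, rfl⟩⟩), one_mul (cs.simple s)⟩
  have hfin : Finite φ.range := inferInstanceAs (Finite (Set.range φ))
  exact Finite.of_injective _ (Subgroup.inclusion_injective hle)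

/-- Compatibility of two vertices of the subdivision. -/
def Compatible (T T' : cs.IrredSpherical) : Prop :=
  T ≤ T' ∨ T' ≤ T ∨ Orthogonal T.1 T'.1 cs

theorem Orthogonal.symm {T T' : Finset B} (h : Orthogonal T T' cs) : Orthogonal T' T cs :=
  fun s hs t ht => ⟨(h t ht s hs).1.symm, fun h' => (h t ht s hs).2 h'.symm⟩

theorem Orthogonal.mono {T T' U : Finset B} (h : Orthogonal T T' cs) (hU : U ⊆ T) :
    Orthogonal U T' cs :=
  fun s hs t ht => h s (hU hs) t ht

theorem Compatible.refl (T : cs.IrredSpherical) : Compatible T T := Or.inl le_rfl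

theorem Compatible.symm {T T' : cs.IrredSpherical} (h : Compatible T T') : Compatible T' T := by
  rcases h with h | h | h
  · exact Or.inr (Or.inl h)
  · exact Or.inl h
  · exact Or.inr (Or.inr h.symm)

theorem Compatible.le_or_le {T T' : cs.IrredSpherical} (h : Compatible T T') {s : B} (hs : s ∈ T.1)
    (hs' : s ∈ T'.1) : T ≤ T' ∨ T' ≤ T := by
  rcases h with h | h | h
  · exact Or.inl h
  · exact Or.inr h
  · exact absurd rfl (h s hs s hs').1

theorem Compatible.le_or_le_of_adj {T T' : cs.IrredSpherical} (h : Compatible T T') {s t : B}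
    (hs : s ∈ T.1) (ht : t ∈ T'.1) (hst : cs.diagram.Adj s t) : T ≤ T' ∨ T' ≤ T := by
  rcases h with h | h | h
  · exact Or.inl h
  · exact Or.inr h
  · exact absurd hst (h s hs t ht).2

/-- Pairwise compatible sets. -/
def PairwiseCompatible (α : Finset cs.IrredSpherical) : Prop :=
  ∀ T ∈ α, ∀ T' ∈ α, Compatible T T'

theorem PairwiseCompatible.subset {α β : Finset cs.IrredSpherical} (h : PairwiseCompatible α)
    (hβ : β ⊆ α) : PairwiseCompatible β :=
  fun T hT T' hT' => h T (hβ hT) T' (hβ hT')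

/-- Peel off a maximal element `T`: every member not below `T` is orthogonal to it, so the support
lies in an orthogonal union of two spherical sets. Thus the sphericity demanded of nested sets is
automatic, which is what makes `L_⊘` flag. -/
theorem PairwiseCompatible.isSpherical {α : Finset cs.IrredSpherical} (h : PairwiseCompatible α) :
    cs.IsSpherical (support α) := by
  classical
  induction hn : α.card using Nat.strong_induction_on generalizing α with
  | _ n ih =>
  rcases α.eq_empty_or_nonempty with rfl | ⟨T₀, hT₀⟩
  · exact (IsNested.empty : cs.IsNested ∅).isSpherical
  obtain ⟨T, -, hT⟩ := α.exists_le_maximal hT₀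
  have hlt : (α.filter fun U => ¬ U ≤ T).card < n := by
    rw [← hn]
    refine Finset.card_lt_card (Finset.ssubset_iff_subset_ne.2 ⟨Finset.filter_subset _ _, ?_⟩)
    intro e
    have := hT.1
    rw [← e] at this
    simp at this
  refine (T.2.1.union (ih _ hlt (h.subset (Finset.filter_subset _ _)) rfl) ?_).mono ?_
  · intro s hs t ht
    obtain ⟨U, hU, htU⟩ := mem_support.1 ht
    obtain ⟨hU, hUT⟩ := Finset.mem_filter.1 hU
    rcases h T hT.1 U hU with h1 | h1 | h1
    · exact absurd (hT.2 hU h1) hUT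
    · exact absurd h1 hUT
    · exact h1 s hs t htU
  · intro s hs
    obtain ⟨U, hU, hsU⟩ := mem_support.1 hs
    by_cases hUT : U ≤ T
    · exact Finset.mem_union_left _ (hUT hsU)
    · exact Finset.mem_union_right _ (mem_support.2 ⟨U, Finset.mem_filter.2 ⟨hU, hUT⟩, hsU⟩)

theorem isNested_iff {α : Finset cs.IrredSpherical} : cs.IsNested α ↔ PairwiseCompatible α :=
  ⟨fun h => h.pairwise, fun h => .of_pairwise h.isSpherical h⟩

theorem mem_subdivision {α : Finset cs.IrredSpherical} :
    α ∈ cs.subdivision ↔ α.Nonempty ∧ PairwiseCompatible α := by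
  rw [← isNested_iff]
  rfl

open scoped Classical in
/-- The complex `L_⊘` is a flag complex. -/
theorem mem_subdivision_of_pairs {α : Finset cs.IrredSpherical} (hne : α.Nonempty)
    (h : ∀ T ∈ α, ∀ T' ∈ α, {T, T'} ∈ cs.subdivision) : α ∈ cs.subdivision :=
  mem_subdivision.2 ⟨hne, fun T hT T' hT' =>
    (mem_subdivision.1 (h T hT T' hT')).2 T (by simp) T' (by simp)⟩

theorem support_nonempty {α : Finset cs.IrredSpherical} (h : α.Nonempty) :
    (support α).Nonempty := by
  obtain ⟨T, hT⟩ := h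
  obtain ⟨⟨v, hv⟩⟩ := T.2.2.nonempty
  exact ⟨v, subset_support hT hv⟩

theorem support_mem_nerve {α : Finset cs.IrredSpherical} (h : α ∈ cs.subdivision) :
    support α ∈ cs.nerve :=
  ⟨support_nonempty (mem_subdivision.1 h).1, (mem_subdivision.1 h).2.isSpherical⟩

/-- `C` is the connected component of `s` in the diagram of `X`. -/
structure IsComponent (X : Finset B) (s : B) (C : cs.IrredSpherical) : Prop where
  mem : s ∈ C.1
  subset : C.1 ⊆ X
  mem_of_adj : ∀ u ∈ C.1, ∀ w ∈ X, cs.diagram.Adj u w → w ∈ C.1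

open scoped Classical in
theorem exists_isComponent {X : Finset B} (hX : cs.IsSpherical X) {s : B} (hs : s ∈ X) :
    ∃ C : cs.IrredSpherical, IsComponent X s C := by
  -- The component is a maximal connected subset of `X` containing `s`; a neighbour outside it could
  -- be added.
  let F := X.powerset.filter fun T : Finset B => s ∈ T ∧ (cs.diagram.induce (T : Set B)).Connected
  have hF : {s} ∈ F := by
    refine Finset.mem_filter.2 ⟨by simpa using hs, by simp, ?_⟩
    have : Subsingleton (({s} : Finset B) : Set B) := by
      rw [Finset.coe_singleton]
      infer_instance
    have : Nonempty (({s} : Finset B) : Set B) := ⟨⟨s, by simp⟩⟩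
    exact ⟨SimpleGraph.Preconnected.of_subsingleton⟩
  obtain ⟨C, -, hC⟩ := F.exists_le_maximal hF
  obtain ⟨h1, h2, h3⟩ := Finset.mem_filter.1 hC.1
  rw [Finset.mem_powerset] at h1
  refine ⟨⟨C, hX.mono h1, h3⟩, h2, h1, fun u hu w hw huw => ?_⟩
  have hu : u ∈ C := hu
  have hmem : insert w C ∈ F := by
    refine Finset.mem_filter.2 ⟨Finset.mem_powerset.2 (Finset.insert_subset hw h1),
      Finset.mem_insert_of_mem h2, ?_⟩
    have h4 := SimpleGraph.induce_union_connected h3.preconnected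
      (SimpleGraph.induce_pair_connected_of_adj huw).preconnected ⟨u, hu, by simp⟩
    have e : ((insert w C : Finset B) : Set B) = (C : Set B) ∪ {u, w} := by
      ext x
      simp only [Finset.coe_insert, Set.mem_insert_iff, Set.mem_union, Set.mem_singleton_iff,
        Finset.mem_coe]
      constructor
      · rintro (h | h)
        · exact Or.inr (Or.inr h)
        · exact Or.inl h
      · rintro (h | rfl | h)
        · exact Or.inr h
        · exact Or.inr hu
        · exact Or.inl h
    rw [e]
    exact h4
  exact hC.2 hmem (Finset.subset_insert _ _) (Finset.mem_insert_self _ _)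

theorem IsComponent.le {X : Finset B} {s : B} {C T : cs.IrredSpherical} (h : IsComponent X s C)
    (hT : T.1 ⊆ X) {u : B} (hu : u ∈ T.1) (huC : u ∈ C.1) : T ≤ C := by
  intro w hw
  by_contra hwC
  obtain ⟨u, -, w, hw, huC, hwC, huw⟩ := exists_adj_of_connected T.2.2 hu huC hw hwC
  exact hwC (h.mem_of_adj u huC w (hT hw) huw)

theorem IsComponent.le_or_orthogonal {X : Finset B} {s : B} {C T : cs.IrredSpherical}
    (h : IsComponent X s C) (hT : T.1 ⊆ X) : T ≤ C ∨ Orthogonal T.1 C.1 cs := by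
  by_cases ho : Orthogonal T.1 C.1 cs
  · exact Or.inr ho
  · left
    unfold Orthogonal at ho
    push Not at ho
    obtain ⟨u, hu, v, hv, huv⟩ := ho
    by_cases e : u = v
    · exact h.le hT hu (e ▸ hv)
    · exact h.le hT hu (h.mem_of_adj v hv u (hT hu) (huv e).symm)

theorem IsComponent.compatible {X : Finset B} {s : B} {C T : cs.IrredSpherical}
    (h : IsComponent X s C) (hT : T.1 ⊆ X) : Compatible T C := by
  rcases h.le_or_orthogonal hT with h | h
  · exact Or.inl h
  · exact Or.inr (Or.inr h)

/-- An edge from `T` to a vertex `w` outside it would make `U` comparable with `T`: `T ≤ U` is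
excluded, and `U ≤ T` would put `w` in `T`. So the connected set `C` cannot leave `T`. This is the
uniqueness principle for all later reconstructions of nested sets. -/
theorem IsComponent.eq {X : Finset B} {s : B} {C T : cs.IrredSpherical} (h : IsComponent X s C)
    (hs : s ∈ T.1) (hT : T.1 ⊆ X)
    (hβ : ∀ w ∈ X, w ∉ T.1 → ∃ U : cs.IrredSpherical, w ∈ U.1 ∧ ¬ T ≤ U ∧ Compatible T U) :
    T = C := by
  refine le_antisymm (h.le hT hs h.mem) fun w hw => ?_
  by_contra hwT
  obtain ⟨u, -, w, hw, huT, hwT, huw⟩ := exists_adj_of_connected C.2.2 h.mem hs hw hwT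
  obtain ⟨U, hwU, h1, h2⟩ := hβ w (h.subset hw) hwT
  rcases h2.le_or_le_of_adj huT hwU huw with h3 | h3
  · exact h1 h3
  · exact hwT (h3 hwU)

/-- Every element of a nested set has a vertex which is in no smaller element. -/
theorem PairwiseCompatible.exists_root {α : Finset cs.IrredSpherical} (h : PairwiseCompatible α)
    (T : cs.IrredSpherical) : ∃ s ∈ T.1, ∀ T' ∈ α, T' < T → s ∉ T'.1 := by
  classical
  by_contra! hcon
  obtain ⟨⟨s, hs⟩⟩ := T.2.2.nonempty
  obtain ⟨T₀, hT₀, hlt₀, -⟩ := hcon s hs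
  -- Take `U` maximal among the members strictly below `T`. As `T` is connected, an edge of `T`
  -- leaves `U`; its end lies in another member below `T`, which adjacency makes comparable with
  -- `U`, contrary to maximality.
  obtain ⟨U, -, hU⟩ := (α.filter (· < T)).exists_le_maximal (Finset.mem_filter.2 ⟨hT₀, hlt₀⟩)
  obtain ⟨hUα, hUT⟩ := Finset.mem_filter.1 hU.1
  obtain ⟨⟨u, hu⟩⟩ := U.2.2.nonempty
  obtain ⟨w, hw, hwU⟩ := Finset.not_subset.1 hUT.not_ge
  obtain ⟨u, -, w, hw, huU, hwU, huw⟩ :=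
    exists_adj_of_connected T.2.2 (hUT.le hu) hu hw hwU
  obtain ⟨T', hT', hlt, hwT'⟩ := hcon w hw
  rcases (h U hUα T' hT').le_or_le_of_adj huU hwT' huw with h1 | h1
  · exact hwU (hU.2 (Finset.mem_filter.2 ⟨hT', hlt⟩) h1 hwT')
  · exact hwU (h1 hwT')

/-- Two members sharing a vertex are comparable, and a root of the larger one avoids the smaller.
Hence any choice of roots is injective on `α`. -/
theorem PairwiseCompatible.eq_of_root {α : Finset cs.IrredSpherical} (h : PairwiseCompatible α)
    {T T' : cs.IrredSpherical} (hT : T ∈ α) (hT' : T' ∈ α) {s : B} (hs : s ∈ T.1) (hs' : s ∈ T'.1)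
    (hr : ∀ U ∈ α, U < T → s ∉ U.1) (hr' : ∀ U ∈ α, U < T' → s ∉ U.1) : T = T' := by
  rcases (h T hT T' hT').le_or_le hs hs' with h1 | h1
  · exact h1.eq_of_not_lt fun h2 => hr' T hT h2 hs
  · exact (h1.eq_of_not_lt fun h2 => hr T' hT' h2 hs').symm

theorem PairwiseCompatible.card_le {α : Finset cs.IrredSpherical} (h : PairwiseCompatible α) :
    α.card ≤ (support α).card := by
  choose f hf hf' using h.exists_root
  refine Finset.card_le_card_of_injOn f (fun T hT => subset_support hT (hf T)) ?_
  intro T hT T' hT' e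
  exact h.eq_of_root hT hT' (hf T) (e ▸ hf T') (hf' T) (e ▸ hf' T')

open scoped Classical in
theorem support_insert (T : cs.IrredSpherical) (α : Finset cs.IrredSpherical) :
    support (insert T α) = T.1 ∪ support α := by
  ext s
  simp [mem_support]

open scoped Classical in
theorem PairwiseCompatible.insert {α : Finset cs.IrredSpherical} (h : PairwiseCompatible α)
    {T : cs.IrredSpherical} (hT : ∀ U ∈ α, Compatible U T) : PairwiseCompatible (insert T α) := by
  intro U hU U' hU'
  rcases Finset.mem_insert.1 hU with e | h1 <;> rcases Finset.mem_insert.1 hU' with e' | h2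
  · rw [e, e']
    exact Compatible.refl _
  · exact e ▸ (hT U' h2).symm
  · exact e' ▸ hT U h1
  · exact h U h1 U' h2

/-- Every simplex of the nerve is the support of a simplex of `L_⊘` of the same dimension. -/
theorem IsSpherical.exists_pairwiseCompatible {σ : Finset B} (hσ : cs.IsSpherical σ) :
    ∃ α : Finset cs.IrredSpherical, PairwiseCompatible α ∧ support α = σ ∧ α.card = σ.card := by
  classical
  induction σ using Finset.induction_on with
  | empty => exact ⟨∅, by simp [PairwiseCompatible], by simp [support], rfl⟩
  | insert s τ hs ih =>
    obtain ⟨α, h1, h2, h3⟩ := ih (hσ.mono (Finset.subset_insert _ _))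
    -- Each new vertex `s` brings one new element: its component in the enlarged set.
    obtain ⟨C, hC⟩ := exists_isComponent hσ (Finset.mem_insert_self s τ)
    have hCα : C ∉ α := fun h => hs (h2 ▸ subset_support h hC.mem)
    refine ⟨insert C α, h1.insert fun U hU => hC.compatible ?_, ?_, ?_⟩
    · exact (subset_support hU).trans (h2 ▸ Finset.subset_insert _ _)
    · rw [support_insert, h2]
      refine Finset.Subset.antisymm (Finset.union_subset hC.subset (Finset.subset_insert _ _)) ?_
      exact Finset.insert_subset (Finset.mem_union_left _ hC.mem) Finset.subset_union_right
    · rw [Finset.card_insert_of_notMem hCα, Finset.card_insert_of_notMem hs, h3]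

theorem subdivision_hasDimension {d : ℕ} (hd : cs.nerve.HasDimension d) :
    cs.subdivision.HasDimension d := by
  constructor
  · obtain ⟨σ, hσ, hc⟩ := hd.1
    obtain ⟨α, h1, h2, h3⟩ := hσ.2.exists_pairwiseCompatible
    exact ⟨α, mem_subdivision.2 ⟨Finset.card_pos.1 (by omega), h1⟩, by omega⟩
  · intro α hα
    exact (mem_subdivision.1 hα).2.card_le.trans (hd.2 _ (support_mem_nerve hα))

end CoxeterSystem

/-! ### Top cycles of the nerve and of its subdivision -/

namespace AbstractSimplicialComplex

/-- A simplicial map commutes with the boundary once degenerate images are dropped. If `f`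
identifies two vertices of `α`, the two faces omitting one of them have the same image and cancel;
any other face is still degenerate. -/
theorem sum_image_erase_eq {V V' : Type*} [DecidableEq V] [Fintype V'] [DecidableEq V'] (f : V → V') {α : Finset V}
    {ρ : Finset V'} (hc : α.card = ρ.card + 1) :
    ∑ x ∈ α, (if (α.erase x).image f = ρ then (1 : ZMod 2) else 0) =
      ∑ y ∈ ρᶜ, if α.image f = insert y ρ then 1 else 0 := by
  by_cases hf : Set.InjOn f α
  · have he : ∀ x ∈ α, (α.erase x).image f = (α.image f).erase (f x) := by
      intro x hx
      ext y
      simp only [Finset.mem_image, Finset.mem_erase]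
      constructor
      · rintro ⟨p, ⟨hne, hp⟩, rfl⟩
        exact ⟨fun e => hne (hf hp hx e), p, hp, rfl⟩
      · rintro ⟨hne, p, hp, rfl⟩
        exact ⟨p, ⟨fun e => hne (e ▸ rfl), hp⟩, rfl⟩
    rw [Finset.sum_congr rfl fun x hx => by rw [he x hx],
      ← Finset.sum_image (f := fun y => if (α.image f).erase y = ρ then (1 : ZMod 2) else 0) hf,
      ← Finset.sum_filter, ← Finset.sum_filter]
    refine Finset.sum_congr ?_ fun _ _ => rfl
    ext y
    rw [Finset.mem_filter, Finset.mem_filter, Finset.mem_compl]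
    constructor
    · rintro ⟨hy, rfl⟩
      exact ⟨Finset.notMem_erase _ _, (Finset.insert_erase hy).symm⟩
    · rintro ⟨hy, e⟩
      rw [e]
      exact ⟨Finset.mem_insert_self _ _, Finset.erase_insert hy⟩
  · have hR : ∑ y ∈ ρᶜ, (if α.image f = insert y ρ then (1 : ZMod 2) else 0) = 0 := by
      refine Finset.sum_eq_zero fun y hy => if_neg fun e => hf ?_
      rw [← Finset.card_image_iff, e, Finset.card_insert_of_notMem (Finset.mem_compl.1 hy), hc]
    rw [hR, ← Finset.sum_filter]
    have hinj : ∀ x ∈ α, (α.erase x).image f = ρ → Set.InjOn f (α.erase x : Finset V) := by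
      intro x hx e
      rw [← Finset.card_image_iff, e, Finset.card_erase_of_mem hx, hc]
      rfl
    have himg : ∀ x ∈ α, ∀ x' ∈ α, x ≠ x' → f x = f x' → (α.erase x).image f = α.image f := by
      intro x hx x' hx' hne e
      refine Finset.Subset.antisymm (Finset.image_subset_image (Finset.erase_subset _ _)) ?_
      intro y hy
      obtain ⟨p, hp, rfl⟩ := Finset.mem_image.1 hy
      by_cases hpx : p = x
      · rw [hpx, e]
        exact Finset.mem_image_of_mem _ (Finset.mem_erase.2 ⟨hne.symm, hx'⟩)
      · exact Finset.mem_image_of_mem _ (Finset.mem_erase.2 ⟨hpx, hp⟩)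
    unfold Set.InjOn at hf
    push Not at hf
    obtain ⟨p, hp, q, hq, hpq, hne⟩ := hf
    have hp : p ∈ α := hp
    have hq : q ∈ α := hq
    have e1 := himg p hp q hq hne hpq
    have e2 := himg q hq p hp hne.symm hpq.symm
    by_cases hρ : α.image f = ρ
    · have : (α.filter fun x => (α.erase x).image f = ρ) = {p, q} := by
        ext x
        simp only [Finset.mem_filter, Finset.mem_insert, Finset.mem_singleton]
        constructor
        · rintro ⟨hx, e⟩
          by_contra! hxpq
          refine hne (hinj x hx e ?_ ?_ hpq)
          · exact Finset.mem_coe.2 (Finset.mem_erase.2 ⟨hxpq.1.symm, hp⟩)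
          · exact Finset.mem_coe.2 (Finset.mem_erase.2 ⟨hxpq.2.symm, hq⟩)
        · rintro (rfl | rfl)
          · exact ⟨hp, e1.trans hρ⟩
          · exact ⟨hq, e2.trans hρ⟩
      rw [this, Finset.sum_pair hne]
      exact CharTwo.add_self_eq_zero _
    · refine Finset.sum_eq_zero fun x hx => ?_
      obtain ⟨hx, e⟩ := Finset.mem_filter.1 hx
      exfalso
      by_cases hxp : p = x
      · exact hρ (by rw [← e1, hxp, e])
      · by_cases hxq : q = x
        · exact hρ (by rw [← e2, hxq, e])
        · refine hne (hinj x hx e ?_ ?_ hpq)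
          · exact Finset.mem_coe.2 (Finset.mem_erase.2 ⟨hxp, hp⟩)
          · exact Finset.mem_coe.2 (Finset.mem_erase.2 ⟨hxq, hq⟩)

/-- The image of a chain of `d`-simplices under a simplicial map. -/
def pushforward {V V' : Type*} [Fintype V] [DecidableEq V'] (f : V → V') (d : ℕ)
    (c : Finset V → ZMod 2) (σ : Finset V') : ZMod 2 :=
  if σ.card = d + 1 then ∑ α, if α.image f = σ then c α else 0 else 0

theorem IsSimplicialCycle.pushforward {V V' : Type*} [Fintype V] [DecidableEq V] [Fintype V']
    [DecidableEq V']
    {K : AbstractSimplicialComplex V} {K' : AbstractSimplicialComplex V'} {d : ℕ}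
    {c : Finset V → ZMod 2} (hc : K.IsSimplicialCycle d c) {f : V → V'}
    (hf : ∀ α ∈ K, α.image f ∈ K') : K'.IsSimplicialCycle d (pushforward f d c) := by
  constructor
  · intro σ hσ
    unfold AbstractSimplicialComplex.pushforward at hσ
    obtain ⟨h1, h2⟩ := ite_ne_right_iff.1 hσ
    obtain ⟨α, -, hα⟩ := Finset.exists_ne_zero_of_sum_ne_zero h2
    obtain ⟨h3, h4⟩ := ite_ne_right_iff.1 hα
    exact ⟨h3 ▸ hf α (hc.1 α h4).1, h1⟩
  · intro ρ
    by_cases hρ : ρ.card = d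
    · have h1 : ∀ y ∈ ρᶜ, AbstractSimplicialComplex.pushforward f d c (insert y ρ) =
          ∑ α, c α * if α.image f = insert y ρ then 1 else 0 := by
        intro y hy
        unfold AbstractSimplicialComplex.pushforward
        rw [if_pos (by rw [Finset.card_insert_of_notMem (Finset.mem_compl.1 hy), hρ])]
        exact Finset.sum_congr rfl fun α _ => by simp
      rw [Finset.sum_congr rfl h1, Finset.sum_comm]
      have h2 := sum_mul_sum_erase c fun β => if β.image f = ρ then 1 else 0
      simp only [hc.2, mul_zero, Finset.sum_const_zero] at h2
      refine Eq.trans ?_ h2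
      refine Finset.sum_congr rfl fun α _ => ?_
      rw [← Finset.mul_sum]
      by_cases hα : c α = 0
      · rw [hα, zero_mul, zero_mul]
      · rw [sum_image_erase_eq f (by rw [(hc.1 α hα).2, hρ])]
    · refine Finset.sum_eq_zero fun y hy => if_neg fun h => hρ ?_
      rw [Finset.card_insert_of_notMem (Finset.mem_compl.1 hy)] at h
      omega

end AbstractSimplicialComplex

/-! ### Transfer of top cycles between `L` and `L_⊘` -/

namespace CoxeterSystem

variable {B W : Type*} [Group W] {M : CoxeterMatrix B} {cs : CoxeterSystem M W}

open scoped Classical in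
theorem IsComponent.support_insert {s : B} {β : Finset cs.IrredSpherical} {C : cs.IrredSpherical}
    (hC : IsComponent (insert s (support β)) s C) :
    support (insert C β) = insert s (support β) := by
  rw [CoxeterSystem.support_insert]
  refine Finset.Subset.antisymm (Finset.union_subset hC.subset (Finset.subset_insert _ _)) ?_
  exact Finset.insert_subset (Finset.mem_union_left _ hC.mem) Finset.subset_union_right

open scoped Classical in
/-- The properties of one of the two ways to complete a nested set which has one element less than
its support: `a` and `b` are the vertices of `T₀` that are in no smaller element. -/
theorem PairwiseCompatible.isComponent_erase {β : Finset cs.IrredSpherical}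
    (h : PairwiseCompatible β) {T₀ C : cs.IrredSpherical} (hT₀ : T₀ ∈ β) {a b : B}
    (ha : ∀ U ∈ β, U < T₀ → a ∉ U.1) (hb : ∀ U ∈ β, U < T₀ → b ∉ U.1)
    (hbT : b ∈ T₀.1) (hC : IsComponent (T₀.1.erase b) a C)
    (hw : ∀ w ∈ T₀.1, w ≠ a → w ≠ b → ∃ U ∈ β, U < T₀ ∧ w ∈ U.1) :
    C ∉ β ∧ PairwiseCompatible (Insert.insert C β) ∧ C ≤ T₀ ∧
      ∀ T : cs.IrredSpherical, PairwiseCompatible (Insert.insert T β) → T ≤ T₀ → a ∈ T.1 →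
        b ∉ T.1 → T = C := by
  have hle : C ≤ T₀ := hC.subset.trans (Finset.erase_subset _ _)
  have hbC : b ∉ C.1 := fun h' => Finset.notMem_erase _ _ (hC.subset h')
  have hlt : C < T₀ := lt_of_le_of_ne hle fun e => hbC (e ▸ hbT)
  refine ⟨fun h' => ha C h' hlt hC.mem, h.insert fun U hU => ?_, hle, fun T hT hTT haT hbT' => ?_⟩
  · rcases h U hU T₀ hT₀ with h1 | h1 | h1
    · rcases h1.eq_or_lt with rfl | h2
      · exact Or.inr (Or.inl hle)
      · refine hC.compatible fun x hx => Finset.mem_erase.2 ⟨fun e => ?_, h1 hx⟩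
        exact hb U hU h2 (e ▸ hx)
    · exact Or.inr (Or.inl (hle.trans h1))
    · exact Or.inr (Or.inr (h1.symm.mono hle).symm)
  -- A vertex of `T₀` other than `a` and `b` lies in a member strictly below `T₀`. That member
  -- avoids the root `a`, so it does not contain `T`.
  · refine hC.eq haT (fun x hx => Finset.mem_erase.2 ⟨fun e => hbT' (e ▸ hx), hTT hx⟩) ?_
    intro w hwX hwT
    obtain ⟨hwb, hwT₀⟩ := Finset.mem_erase.1 hwX
    obtain ⟨U, hU, hUlt, hwU⟩ := hw w hwT₀ (fun e => hwT (e ▸ haT)) hwb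
    exact ⟨U, hwU, fun h' => ha U hU hUlt (h' haT),
      hT T (Finset.mem_insert_self _ _) U (Finset.mem_insert_of_mem hU)⟩

open scoped Classical in
/-- A nested set with one element less than its support can be completed in exactly two ways. -/
theorem PairwiseCompatible.exists_two_completions {β : Finset cs.IrredSpherical}
    (h : PairwiseCompatible β) (hcard : (support β).card = β.card + 1) :
    ∃ C C' : cs.IrredSpherical, C ≠ C' ∧ ∀ T : cs.IrredSpherical,
      (T ∉ β ∧ PairwiseCompatible (Insert.insert T β) ∧ T.1 ⊆ support β) ↔ T = C ∨ T = C' := by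
  choose f hf hf' using h.exists_root
  have hinj : Set.InjOn f β := fun T hT T' hT' e =>
    h.eq_of_root hT hT' (hf T) (e ▸ hf T') (hf' T) (e ▸ hf' T')
  have hsub : β.image f ⊆ support β := by
    intro s hs
    obtain ⟨T, hT, rfl⟩ := Finset.mem_image.1 hs
    exact subset_support hT (hf T)
  have hcimg : (β.image f).card = β.card := Finset.card_image_of_injOn hinj
  -- The chosen roots are distinct and number one less than the vertices of the support, so exactly
  -- one vertex `b` is left over. The smallest member `T₀` containing `b` then has the two roots `f
  -- T₀` and `b`, and every other member has just one.
  obtain ⟨b, hb, hbf⟩ := Finset.exists_of_ssubset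
    (Finset.ssubset_iff_subset_ne.2 ⟨hsub, fun e => by rw [e] at hcimg; omega⟩)
  have himg : Insert.insert b (β.image f) = support β :=
    Finset.eq_of_subset_of_card_le (Finset.insert_subset hb hsub) (by
      rw [Finset.card_insert_of_notMem hbf, hcimg, hcard])
  obtain ⟨T₁, hT₁, hbT₁⟩ := mem_support.1 hb
  obtain ⟨T₀, -, hmin⟩ := (β.filter fun T => b ∈ T.1).exists_le_minimal
    (Finset.mem_filter.2 ⟨hT₁, hbT₁⟩)
  obtain ⟨hT₀, hbT₀⟩ := Finset.mem_filter.1 hmin.1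
  have hbroot : ∀ U ∈ β, U < T₀ → b ∉ U.1 := fun U hU hlt hbU =>
    hlt.not_ge (hmin.2 (Finset.mem_filter.2 ⟨hU, hbU⟩) hlt.le)
  have hab : f T₀ ≠ b := fun e => hbf (e ▸ Finset.mem_image_of_mem f hT₀)
  have hw : ∀ w ∈ T₀.1, w ≠ f T₀ → w ≠ b → ∃ U ∈ β, U < T₀ ∧ w ∈ U.1 := by
    intro w hw hwa hwb
    have hwτ := subset_support hT₀ hw
    rw [← himg] at hwτ
    obtain ⟨U, hU, rfl⟩ := Finset.mem_image.1 ((Finset.mem_insert.1 hwτ).resolve_left hwb)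
    refine ⟨U, hU, ?_, hf U⟩
    rcases (h U hU T₀ hT₀).le_or_le (hf U) hw with h1 | h1
    · exact lt_of_le_of_ne h1 fun e => hwa (e ▸ rfl)
    · rcases h1.eq_or_lt with e | h2
      · exact absurd (e ▸ rfl) hwa
      · exact absurd hw (hf' U T₀ hT₀ h2)
  obtain ⟨C, hC⟩ := exists_isComponent (T₀.2.1.mono (Finset.erase_subset b _))
    (Finset.mem_erase.2 ⟨hab, hf T₀⟩)
  obtain ⟨C', hC'⟩ := exists_isComponent (T₀.2.1.mono (Finset.erase_subset (f T₀) _))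
    (Finset.mem_erase.2 ⟨hab.symm, hbT₀⟩)
  obtain ⟨c1, c2, c3, c4⟩ := h.isComponent_erase hT₀ (hf' T₀) hbroot hbT₀ hC hw
  obtain ⟨d1, d2, d3, d4⟩ := h.isComponent_erase hT₀ hbroot (hf' T₀) (hf T₀) hC'
    fun w hw1 hw2 hw3 => hw w hw1 hw3 hw2
  refine ⟨C, C', ?_, fun T => ⟨?_, ?_⟩⟩
  · rintro rfl
    exact Finset.notMem_erase _ _ (hC.subset hC'.mem)
  · rintro ⟨hTβ, hT, hTsub⟩
    have hmono : ∀ {U}, U ∈ β → U ∈ Insert.insert T β := Finset.mem_insert_of_mem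
    obtain ⟨x, hxT, hxr⟩ := hT.exists_root T
    -- a vertex of the support is the chosen root of an element of `β`, or equal to `b`
    have hroot : ∀ x ∈ support β, ∃ U ∈ β, x ∈ U.1 ∧ (∀ U' ∈ β, U' < U → x ∉ U'.1) ∧
        (x = f U ∨ (x = b ∧ U = T₀)) := by
      intro x hx
      rw [← himg] at hx
      rcases Finset.mem_insert.1 hx with rfl | hx
      · exact ⟨T₀, hT₀, hbT₀, hbroot, Or.inr ⟨rfl, rfl⟩⟩
      · obtain ⟨U, hU, rfl⟩ := Finset.mem_image.1 hx
        exact ⟨U, hU, hf U, hf' U, Or.inl rfl⟩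
    -- For a completion by `T`, a root `x` of `T` is also a root of some `U` in `β`, which forces `T
    -- < U`. In the enlarged set `U` has a root `y` outside `T`. So `U` has two distinct roots in
    -- `β`, and must be `T₀`.
    obtain ⟨U, hU, hxU, hxrU, hx⟩ := hroot x (hTsub hxT)
    have hTU : T < U := by
      rcases (hT T (Finset.mem_insert_self _ _) U (hmono hU)).le_or_le hxT hxU with h1 | h1
      · exact lt_of_le_of_ne h1 fun e => hTβ (e ▸ hU)
      · exact absurd hxU (hxr U (hmono hU) (lt_of_le_of_ne h1 fun e => hTβ (e ▸ hU)))
    obtain ⟨y, hyU, hyr⟩ := hT.exists_root U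
    have hyT : y ∉ T.1 := hyr T (Finset.mem_insert_self _ _) hTU
    obtain ⟨U', hU', hyU', hyrU', hy⟩ := hroot y (subset_support hU hyU)
    obtain rfl : U = U' := h.eq_of_root hU hU' hyU hyU' (fun V hV => hyr V (hmono hV)) hyrU'
    have hxy : x ≠ y := fun e => hyT (e ▸ hxT)
    -- The roots `x` and `y` are `f T₀` and `b` in one order or the other; each order pins down one
    -- of the two components.
    rcases hx with hx | ⟨hx, hx'⟩ <;> rcases hy with hy | ⟨hy, hy'⟩
    · exact absurd (hx.trans hy.symm) hxy
    · exact Or.inl (c4 T hT (hy' ▸ hTU.le) (by rwa [← hy', ← hx]) (hy ▸ hyT))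
    · exact Or.inr (d4 T hT (hx' ▸ hTU.le) (hx ▸ hxT) (by rwa [← hx', ← hy]))
    · exact absurd (hx.trans hy.symm) hxy
  · rintro (rfl | rfl)
    · exact ⟨c1, c2, Finset.Subset.trans c3 (subset_support hT₀)⟩
    · exact ⟨d1, d2, Finset.Subset.trans d3 (subset_support hT₀)⟩

theorem PairwiseCompatible.card_support_le {d : ℕ} (hd : cs.nerve.HasDimension d)
    {α : Finset cs.IrredSpherical} (h : PairwiseCompatible α) : (support α).card ≤ d + 1 := by
  rcases (support α).eq_empty_or_nonempty with he | hne
  · simp [he]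
  · exact hd.2 _ ⟨hne, h.isSpherical⟩

open scoped Classical in
/-- The subdivision of a chain of `d`-simplices of the nerve. -/
noncomputable def subdivide (cs : CoxeterSystem M W) (d : ℕ) (c : Finset B → ZMod 2)
    (α : Finset cs.IrredSpherical) : ZMod 2 :=
  if PairwiseCompatible α ∧ α.card = d + 1 then c (support α) else 0

open scoped Classical in
theorem isSimplicialCycle_subdivide [Fintype B] {d : ℕ} (hd : cs.nerve.HasDimension d)
    {c : Finset B → ZMod 2} (hc : cs.nerve.IsSimplicialCycle d c) :
    cs.subdivision.IsSimplicialCycle d (cs.subdivide d c) := by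
  constructor
  · intro α hα
    obtain ⟨⟨h1, h2⟩, -⟩ := ite_ne_right_iff.1 hα
    exact ⟨mem_subdivision.2 ⟨Finset.card_pos.1 (by omega), h1⟩, h2⟩
  · intro β
    by_cases hβ : PairwiseCompatible β ∧ β.card = d
    swap
    · refine Finset.sum_eq_zero fun T hT => if_neg fun h => hβ ⟨h.1.subset (Finset.subset_insert _ _), ?_⟩
      have := h.2
      rw [Finset.card_insert_of_notMem (Finset.mem_compl.1 hT)] at this
      omega
    obtain ⟨hβ, hβc⟩ := hβ
    have hcard : ∀ {T}, T ∉ β → (insert T β).card = d + 1 := fun hT => by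
      rw [Finset.card_insert_of_notMem hT, hβc]
    have hle := hβ.card_le
    have hle' := hβ.card_support_le hd
    -- The support has `d` or `d + 1` vertices. With `d` vertices, a completion that counts adds a
    -- single vertex `s` and has to be the component of `s`, so the sum is the cycle condition for
    -- `c` at the support.
    by_cases hτ : (support β).card = d
    · rw [← hc.2 (support β)]
      symm
      have hsph : ∀ s, c (insert s (support β)) ≠ 0 → ∃ C : cs.IrredSpherical,
          IsComponent (insert s (support β)) s C := fun s hs =>
        exists_isComponent (hc.1 _ hs).1.2 (Finset.mem_insert_self _ _)
      choose C hC using hsph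
      have hCβ : ∀ s hs, s ∈ (support β)ᶜ → C s hs ∉ β := fun s hs hsβ h' =>
        Finset.mem_compl.1 hsβ (subset_support h' (hC s hs).mem)
      have hval : ∀ s hs, s ∈ (support β)ᶜ →
          c (insert s (support β)) = cs.subdivide d c (insert (C s hs) β) := by
        intro s hs hsβ
        unfold subdivide
        rw [if_pos ⟨hβ.insert fun U hU => (hC s hs).compatible
          ((subset_support hU).trans (Finset.subset_insert _ _)), hcard (hCβ s hs hsβ)⟩,
          (hC s hs).support_insert]
      refine Finset.sum_bij_ne_zero (fun s _ hs => C s hs) ?_ ?_ ?_ ?_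
      · exact fun s hsβ hs => Finset.mem_compl.2 (hCβ s hs hsβ)
      · intro s hsβ hs s' hsβ' hs' e
        have h1 := (hC s' hs').subset (e ▸ (hC s hs).mem)
        exact (Finset.mem_insert.1 h1).resolve_right (Finset.mem_compl.1 hsβ)
      · intro T hTβ hT
        obtain ⟨⟨h1, h2⟩, h3⟩ := ite_ne_right_iff.1 hT
        have h4 := (hc.1 _ h3).2
        rw [support_insert] at h3 h4
        obtain ⟨s, hs, hsβ⟩ := Finset.exists_of_ssubset (Finset.ssubset_iff_subset_ne.2
          ⟨(Finset.subset_union_right : support β ⊆ T.1 ∪ support β),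
            fun e => by rw [← e] at h4; omega⟩)
        have hsT : s ∈ T.1 := (Finset.mem_union.1 hs).resolve_right hsβ
        have e : insert s (support β) = T.1 ∪ support β :=
          Finset.eq_of_subset_of_card_le (Finset.insert_subset hs Finset.subset_union_right) (by
            rw [Finset.card_insert_of_notMem hsβ]; omega)
        rw [← e] at h3
        refine ⟨s, Finset.mem_compl.2 hsβ, h3, ((hC s h3).eq hsT ?_ ?_).symm⟩
        · rw [e]
          exact Finset.subset_union_left
        · intro w hw hwT
          obtain ⟨U, hU, hwU⟩ := mem_support.1 ((Finset.mem_insert.1 hw).resolve_left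
            fun e' => hwT (e' ▸ hsT))
          exact ⟨U, hwU, fun h' => hsβ (subset_support hU (h' hsT)),
            h1 T (Finset.mem_insert_self _ _) U (Finset.mem_insert_of_mem hU)⟩
      · exact fun s hsβ hs => hval s hs hsβ
    -- The support is already of maximal size, so completions do not enlarge it; the two of them
    -- carry the same value of `c` and cancel.
    · obtain ⟨C, C', hne, hCC⟩ := hβ.exists_two_completions (by omega)
      have hiff : ∀ T, T ∉ β ∧ PairwiseCompatible (insert T β) ↔ T = C ∨ T = C' := by
        intro T
        rw [← hCC]
        refine ⟨fun ⟨hT, hTβ⟩ => ⟨hT, hTβ, ?_⟩, fun h => ⟨h.1, h.2.1⟩⟩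
        have h1 := hTβ.card_support_le hd
        rw [support_insert] at h1
        rw [Finset.eq_of_subset_of_card_le (Finset.subset_union_right :
          support β ⊆ T.1 ∪ support β) (by omega)]
        exact Finset.subset_union_left
      have hval : ∀ T, T ∉ β ∧ PairwiseCompatible (insert T β) →
          cs.subdivide d c (insert T β) = c (support β) := by
        rintro T ⟨hT, hTβ⟩
        unfold subdivide
        have hsub := ((hCC T).2 ((hiff T).1 ⟨hT, hTβ⟩)).2.2
        rw [if_pos ⟨hTβ, hcard hT⟩, support_insert, Finset.union_eq_right.2 hsub]
      have hC := (hiff C).2 (Or.inl rfl)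
      have hC' := (hiff C').2 (Or.inr rfl)
      rw [← Finset.sum_subset (s₁ := {C, C'})]
      · rw [Finset.sum_pair hne, hval C hC, hval C' hC']
        exact CharTwo.add_self_eq_zero _
      · intro T hT
        rw [Finset.mem_insert, Finset.mem_singleton, ← hiff] at hT
        exact Finset.mem_compl.2 hT.1
      · intro T hT hT'
        rw [Finset.mem_insert, Finset.mem_singleton, ← hiff] at hT'
        exact if_neg fun h' => hT' ⟨Finset.mem_compl.1 hT, h'.1⟩

/-- Every top simplex of the nerve is the support of a nested set with equally many elements. -/
theorem subdivide_ne_zero [Fintype B] [DecidableEq B] {d : ℕ} {c : Finset B → ZMod 2}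
    (hc : cs.nerve.IsSimplicialCycle d c) (hne : c ≠ 0) : cs.subdivide d c ≠ 0 := by
  obtain ⟨σ, hσ⟩ := Function.ne_iff.1 hne
  obtain ⟨h1, h2⟩ := hc.1 σ hσ
  obtain ⟨α, h3, h4, h5⟩ := h1.2.exists_pairwiseCompatible
  refine fun h => hσ ?_
  have := congrFun h α
  unfold subdivide at this
  rwa [if_pos ⟨h3, by omega⟩, h4] at this

/-- A nested set with as many elements as its support is determined by the set of the least
elements of its members. -/
theorem PairwiseCompatible.subset_of_image_eq {r : B → ℕ} (hr : Function.Injective r)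
    {f : cs.IrredSpherical → B} (hf : ∀ T, f T ∈ T.1) (hmin : ∀ T, ∀ t ∈ T.1, r (f T) ≤ r t)
    {α α' : Finset cs.IrredSpherical} (h : PairwiseCompatible α) (h' : PairwiseCompatible α')
    (hα : ∀ s, s ∈ support α ↔ ∃ T ∈ α, f T = s) (hα' : ∀ s, s ∈ support α' ↔ ∃ T ∈ α', f T = s)
    (he : support α = support α') : α ⊆ α' := by
  classical
  have key : ∀ {α : Finset cs.IrredSpherical}, PairwiseCompatible α →
      (∀ s, s ∈ support α ↔ ∃ T ∈ α, f T = s) → ∀ T ∈ α, ∀ C : cs.IrredSpherical,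
      IsComponent ((support α).filter fun t => r (f T) ≤ r t) (f T) C → T = C := by
    intro α h hα T hT C hC
    -- A member `T` is recovered as the component of `f T` among the vertices of the support that do
    -- not precede it. Any other such vertex is `f U` for a member `U`; if `U` contained `T`, its
    -- least vertex could only be `f T`.
    refine hC.eq (hf T) ?_ ?_
    · exact fun t ht => Finset.mem_filter.2 ⟨subset_support hT ht, hmin T t ht⟩
    · intro w hw hwT
      obtain ⟨hw, hrw⟩ := Finset.mem_filter.1 hw
      obtain ⟨U, hU, rfl⟩ := (hα w).1 hw
      refine ⟨U, hf U, fun hTU => hwT ?_, h T hT U hU⟩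
      rw [hr (le_antisymm (hmin U _ (hTU (hf T))) hrw)]
      exact hf T
  intro T hT
  have hs := (hα (f T)).2 ⟨T, hT, rfl⟩
  obtain ⟨C, hC⟩ := exists_isComponent
    (h.isSpherical.mono (Finset.filter_subset (fun t => r (f T) ≤ r t) _))
    (Finset.mem_filter.2 ⟨hs, le_rfl⟩)
  obtain ⟨T', hT', e⟩ := (hα' (f T)).1 (he ▸ hs)
  have h1 := key h hα T hT C hC
  have h2 := key h' hα' T' hT' C (by rw [e, ← he]; exact hC)
  rwa [h1, ← h2]

open scoped Classical in
/-- A nonzero top cycle of the subdivision yields one of the nerve. -/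
theorem exists_isSimplicialCycle_nerve [Fintype B] {d : ℕ} (hd : cs.nerve.HasDimension d)
    {c : Finset cs.IrredSpherical → ZMod 2} (hc : cs.subdivision.IsSimplicialCycle d c)
    (hne : c ≠ 0) : ∃ c', cs.nerve.IsSimplicialCycle d c' ∧ c' ≠ 0 := by
  obtain ⟨α, hα⟩ := Function.ne_iff.1 hne
  have hα' := (mem_subdivision.1 (hc.1 α hα).1).2
  -- `N s` counts the members of `α` containing `s`. Within a member `T`, a root lies in no members
  -- other than those containing `T`, so it minimizes `N`. Ordering by `N`, with ties broken
  -- arbitrarily, therefore makes the least vertex of `T` a root.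
  let N : B → ℕ := fun s => (α.filter fun T => s ∈ T.1).card
  obtain ⟨r, hr, hNr⟩ : ∃ r : B → ℕ, Function.Injective r ∧ ∀ s t, N s < N t → r s < r t := by
    let e := Fintype.equivFin B
    have hlt : ∀ s t, N s < N t →
        N s * Fintype.card B + (e s : ℕ) < N t * Fintype.card B + (e t : ℕ) := by
      intro s t hst
      have h1 := Nat.mul_le_mul_right (Fintype.card B) (Nat.succ_le_of_lt hst)
      have h2 := (e s).2
      rw [Nat.succ_mul] at h1
      omega
    refine ⟨fun s => N s * Fintype.card B + e s, fun s t hst => ?_, hlt⟩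
    dsimp only at hst
    rcases lt_trichotomy (N s) (N t) with h | h | h
    · exact absurd hst (hlt s t h).ne
    · rw [h] at hst
      exact e.injective (Fin.ext (by omega))
    · exact absurd hst (hlt t s h).ne'
  have hex : ∀ T : cs.IrredSpherical, ∃ s ∈ T.1, ∀ t ∈ T.1, r s ≤ r t := by
    intro T
    obtain ⟨⟨v, hv⟩⟩ := T.2.2.nonempty
    exact T.1.exists_min_image r ⟨v, hv⟩
  choose f hf hmin using hex
  have hsub : ∀ α : Finset cs.IrredSpherical, α.image f ⊆ support α := by
    intro α s hs
    obtain ⟨T, hT, rfl⟩ := Finset.mem_image.1 hs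
    exact subset_support hT (hf T)
  have hroot : ∀ T ∈ α, ∀ U ∈ α, U < T → f T ∉ U.1 := by
    intro T hT U hU hUT hfU
    obtain ⟨s, hs, hs'⟩ := hα'.exists_root T
    refine (hmin T s hs).not_gt (hNr _ _ ?_)
    refine Finset.card_lt_card (Finset.ssubset_iff_of_subset ?_ |>.2 ⟨U, ?_, ?_⟩)
    · intro T' hT'
      obtain ⟨hT'α, hsT'⟩ := Finset.mem_filter.1 hT'
      refine Finset.mem_filter.2 ⟨hT'α, ?_⟩
      rcases (hα' T hT T' hT'α).le_or_le hs hsT' with h | h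
      · exact h (hf T)
      · rcases h.eq_or_lt with rfl | h
        · exact hf _
        · exact absurd hsT' (hs' T' hT'α h)
    · exact Finset.mem_filter.2 ⟨hU, hfU⟩
    · exact fun h => hs' U hU hUT (Finset.mem_filter.1 h).2
  have hinj : Set.InjOn f α := fun T hT T' hT' e =>
    hα'.eq_of_root hT hT' (hf T) (e ▸ hf T') (hroot T hT) (e ▸ hroot T' hT')
  have hcard : (α.image f).card = d + 1 := by
    rw [Finset.card_image_of_injOn hinj, (hc.1 α hα).2]
  have hsupp : ∀ {β : Finset cs.IrredSpherical}, c β ≠ 0 → β.image f = α.image f →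
      support β = α.image f := by
    intro β hβ e
    rw [← e]
    -- The image already has the largest possible number `d + 1` of vertices, so it fills the
    -- support.
    refine (Finset.eq_of_subset_of_card_le (hsub β) ?_).symm
    rw [e, hcard]
    exact (mem_subdivision.1 (hc.1 β hβ).1).2.card_support_le hd
  refine ⟨_, hc.pushforward (f := f) fun β hβ => ?_, fun h0 => ?_⟩
  · obtain ⟨h1, h2⟩ := mem_subdivision.1 hβ
    exact ⟨h1.image f, h2.isSpherical.mono (hsub β)⟩
  · have h1 := congrFun h0 (α.image f)
    unfold AbstractSimplicialComplex.pushforward at h1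
    rw [if_pos hcard, Finset.sum_eq_single α] at h1
    · rw [if_pos rfl] at h1
      exact hα h1
    -- Another simplex of the cycle with the same image has the same support and the same least
    -- vertices, hence the same members; so the pushforward at the image of `α` is `c α`.
    · intro β _ hβα
      by_contra hβ
      obtain ⟨e, hβ⟩ := ite_ne_right_iff.1 hβ
      have hβ' := (mem_subdivision.1 (hc.1 β hβ).1).2
      have m1 : ∀ s, s ∈ support α ↔ ∃ T ∈ α, f T = s := fun s => by
        rw [hsupp hα rfl, Finset.mem_image]
      have m2 : ∀ s, s ∈ support β ↔ ∃ T ∈ β, f T = s := fun s => by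
        rw [hsupp hβ e, ← e, Finset.mem_image]
      have e' : support β = support α := (hsupp hβ e).trans (hsupp hα rfl).symm
      exact hβα (Finset.Subset.antisymm (hβ'.subset_of_image_eq hr hf hmin hα' m2 m1 e')
        (hα'.subset_of_image_eq hr hf hmin hβ' m1 m2 e'.symm))
    · exact fun h => absurd (Finset.mem_univ _) h

/-- The nerve has top homology iff its subdivision does. -/
theorem nontrivial_homology_subdivision_iff [Finite B] {n : ℕ}
    (hd : cs.nerve.HasDimension (n + 1)) :
    Nontrivial (cs.subdivision.Homology (n + 1)) ↔ Nontrivial (cs.nerve.Homology (n + 1)) := by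
  classical
  cases nonempty_fintype B
  rw [AbstractSimplicialComplex.nontrivial_homology_succ_iff hd,
    AbstractSimplicialComplex.nontrivial_homology_succ_iff (subdivision_hasDimension hd)]
  constructor
  · rintro ⟨c, hc, hne⟩
    exact exists_isSimplicialCycle_nerve hd hc hne
  · rintro ⟨c, hc, hne⟩
    exact ⟨_, isSimplicialCycle_subdivide hd hc, subdivide_ne_zero hc hne⟩

end CoxeterSystem

theorem theorem3p3 {B : Type*} [Finite B] {W : Type*} [Group W] {M : CoxeterMatrix B}
    (cs : CoxeterSystem M W) (d : ℕ) (hd : cs.nerve.HasDimension d) :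
    cs.subdivision.octahedralization.IsObstructor (2 * d) ↔ Nontrivial (cs.nerve.Homology d) := by
  classical
  have hd' := CoxeterSystem.subdivision_hasDimension hd
  cases nonempty_fintype B
  cases d with
  | zero =>
    -- In dimension zero both sides hold: the two lifts of one vertex form a `0`-cell, on which
    -- `w^0` is one, and unreduced `H_0` is nonzero.
    refine iff_of_true (AbstractSimplicialComplex.isObstructor_zero ?_)
      (AbstractSimplicialComplex.nontrivial_homology_zero hd)
    obtain ⟨α, hα, -⟩ := hd'.1
    obtain ⟨T, -⟩ := AbstractSimplicialComplex.nonempty_of_mem hα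
    exact ⟨⟨({(T, true)}, {(T, false)}), AbstractSimplicialComplex.singleton_mem _ _,
      AbstractSimplicialComplex.singleton_mem _ _, by simp, by simp⟩⟩
  | succ n =>
    rw [← CoxeterSystem.nontrivial_homology_subdivision_iff hd]
    constructor
    · intro h
      by_contra hH
      exact AbstractSimplicialComplex.not_isObstructor_octahedralization hd' hH h
    · intro h
      obtain ⟨c, hc, hne⟩ := (AbstractSimplicialComplex.nontrivial_homology_succ_iff hd').1 h
      exact AbstractSimplicialComplex.isObstructor_octahedralization hd'
        (fun α => CoxeterSystem.mem_subdivision_of_pairs) hc hne
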